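/- Let $d$ be a natural number, let $\kappa_1,\dots,\kappa_d\ge 0$ be real numbers, and let $\mu_\kappa$ be the measure on $\mathbb R^d$ given by $\mathrm d\mu_\kappa(x)=h_\kappa(x)^2\,\mathrm dx$ with $h_\kappa(x)=\prod_{j=1}^d|x_j|^{\kappa_j}$. Write $\|\cdot\|_{\kappa,p}$ for the norm of $L^p(\mu_\kappa)=L^p(\mathbb R^d;\mathrm d\mu_\kappa)$. For $x\in\mathbb R^d$ and $r>0$ put $R(x,r)=I(x_1,r)\times\cdots\times I(x_d,r)$, where $I(t,r)=\bigl[\max\{0,|t|-r\},\,|t|+r\bigr)$ for $t\in\mathbb R$, and put $\tilde y=(|y_1|,\dots,|y_d|)$ for $y\in\mathbb R^d$. For a measurable function $f:\mathbb R^d\to\mathbb C$ define the $[0,\infty]$-valued function \[ M^R_\kappa f(x)=\sup_{r>0}\frac{1}{\mu_\kappa(R(x,r))}\int_{\{y\in\mathbb R^d:\ \tilde y\in R(x,r)\}}|f(y)|\,\mathrm d\mu_\kappa(y),\qquad x\in\mathbb R^d . \] Let $(f_n)_{n\ge1}$ be a sequence of measurable functions $\mathbb R^d\to\mathbb C$.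 (1) If $1<r<\infty$, $1<p<\infty$ and $\bigl(\sum_{n=1}^\infty|f_n(\cdot)|^r\bigr)^{1/r}\in L^p(\mu_\kappa)$, then $\bigl(\sum_{n=1}^\infty|M^R_\kappa f_n(\cdot)|^r\bigr)^{1/r}\in L^p(\mu_\kappa)$ and \[ \Bigl\|\Bigl(\sum_{n=1}^\infty|M^R_\kappa f_n(\cdot)|^r\Bigr)^{1/r}\Bigr\|_{\kappa,p}\le C\,\Bigl\|\Bigl(\sum_{n=1}^\infty|f_n(\cdot)|^r\Bigr)^{1/r}\Bigr\|_{\kappa,p}, \] where $C=C(\kappa_1,\dots,\kappa_d,r,p)>0$ is independent of $(f_n)_{n\ge1}$. (2) If $1<r<\infty$ and $\bigl(\sum_{n=1}^\infty|f_n(\cdot)|^r\bigr)^{1/r}\in L^1(\mu_\kappa)$, then for every $\lambda>0$ \[ \mu_\kappa\Bigl(\Bigl\{x\in\mathbb R^d:\ \Bigl(\sum_{n=1}^\infty|M^R_\kappa f_n(x)|^r\Bigr)^{1/r}>\lambda\Bigr\}\Bigr)\le\frac{C}{\lambda}\,\Bigl\|\Bigl(\sum_{n=1}^\infty|f_n(\cdot)|^r\Bigr)^{1/r}\Bigr\|_{\kappa,1},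 \] where $C=C(\kappa_1,\dots,\kappa_d,r)>0$ is independent of $(f_n)_{n\ge1}$ and $\lambda$. -/

import Mathlib

open MeasureTheory
open scoped ENNReal NNReal

namespace Dunkl

noncomputable section

/-- The weight `h_κ(x) = ∏ j, |x j| ^ κ j` on `ℝ^d`. -/
def weight {d : ℕ} (κ : Fin d → ℝ) (x : Fin d → ℝ) : ℝ :=
  ∏ j, |x j| ^ κ j

/-- The measure `dμ_κ(x) = h_κ(x)^2 dx` on `ℝ^d`. -/
def mu {d : ℕ} (κ : Fin d → ℝ) : Measure (Fin d → ℝ) :=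
  volume.withDensity fun x => ENNReal.ofReal (weight κ x ^ 2)

/-- The interval `I(x, r) = [max {0, |x| - r}, |x| + r)`. -/
def interval (x r : ℝ) : Set ℝ :=
  Set.Ico (max 0 (|x| - r)) (|x| + r)

/-- The rectangle `R(x, r) = I(x_1, r) × ⋯ × I(x_d, r)`. -/
def rect {d : ℕ} (x : Fin d → ℝ) (r : ℝ) : Set (Fin d → ℝ) :=
  Set.univ.pi fun j => interval (x j) r

/-- The point `ỹ = (|y_1|, …, |y_d|)`. -/
def absCoord {d : ℕ} (y : Fin d → ℝ) : Fin d → ℝ :=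
  fun j => |y j|

/-- The weighted maximal operator `M^R_κ`, with values in `[0, ∞]`. -/
def maximalR {d : ℕ} (κ : Fin d → ℝ) (f : (Fin d → ℝ) → ℂ) (x : Fin d → ℝ) : ℝ≥0∞ :=
  ⨆ (r : ℝ) (_ : 0 < r),
    (mu κ (rect x r))⁻¹ * ∫⁻ y in {y | absCoord y ∈ rect x r}, ‖f y‖ₑ ∂(mu κ)

/-- The pointwise norm `(∑ n, (g_n(x))^r)^(1/r)` of a sequence of `[0, ∞]`-valued functions,
with values in `[0, ∞]`. -/
def lrNorm {d : ℕ} (r : ℝ) (g : ℕ → (Fin d → ℝ) → ℝ≥0∞) (x : Fin d → ℝ) : ℝ≥0∞ :=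
  (∑' n, g n x ^ r) ^ (1 / r)

end

end Dunkl

/-! The measure is doubling, so the inequalities follow from the Fefferman–Stein inequalities for
dyadic maximal functions, once the operator is dominated by finitely many of these.

Domination (`maximalR_le`). In each coordinate take the dyadic grid on the half line or its
one-third shift, and pull the products back under `x ↦ (|x_1|, …, |x_d|)`. This gives `2 ^ d` nested
families of cells that are symmetric under sign changes. Each set `{y | absCoord y ∈ rect x r}` lies
in a cell of side comparable to `r` from one of them. The weight is even and has power growth, so
the measure of this symmetric cell is at most a constant times that of `rect x r`, although the
latter lies in a single orthant (`mu_absCoord_mem_rect_le_mul_box`).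

Dyadic inequalities. Averaging over the cells of any countable partition is self-adjoint
(`lintegral_condE_mul`). For the partition into stopping cells, the largest cells where the average
of `u` exceeds `a`, this gives `a ∫_{Mu > a} w ≤ ∫ u Mw` with no covering argument. Interpolation
with the trivial `L^∞` bound yields `∫ (Mu)^r w ≤ C ∫ u^r Mw`, which can be summed over a sequence.
With `w = 1` this is the case `p = r`. For `p > r` one tests against a power of the left side and
uses the scalar bound for `Mw`. At the endpoint `p = 1`, each function is averaged over the stopping
cells of the `ℓ^r` norm `F`. This leaves the maximal functions unchanged wherever `MF ≤ a`, and the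
averaged sequence has bounded `ℓ^r` norm, so the case `p = r` and Chebyshev apply. The range `1 < p
< r` follows by interpolation.

Only finitely many levels are used at a time, so that a largest stopping cell exists. The constants
do not depend on the levels, and monotone convergence recovers all scales. -/

namespace Dunkl

/-! ### `ℓ^r` norms of sequences in `[0, ∞]`. -/

/-- The `ℓ^r` norm of a sequence in `[0, ∞]`. -/
noncomputable def lr (r : ℝ) (v : ℕ → ℝ≥0∞) : ℝ≥0∞ := (∑' n, v n ^ r) ^ (1 / r)

theorem lr_rpow {r : ℝ} (hr : 0 < r) (v : ℕ → ℝ≥0∞) : lr r v ^ r = ∑' n, v n ^ r := by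
  rw [lr, ← ENNReal.rpow_mul, one_div_mul_cancel hr.ne', ENNReal.rpow_one]

theorem lr_mono {r : ℝ} (hr : 0 < r) {u v : ℕ → ℝ≥0∞} (h : ∀ n, u n ≤ v n) :
    lr r u ≤ lr r v := by
  unfold lr
  gcongr with n
  exact h n

theorem le_lr {r : ℝ} (hr : 0 < r) (v : ℕ → ℝ≥0∞) (n : ℕ) : v n ≤ lr r v := by
  have h : v n ^ r ≤ lr r v ^ r := by
    rw [lr_rpow hr]
    exact ENNReal.le_tsum n
  exact (ENNReal.rpow_le_rpow_iff hr).1 h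

theorem lr_add_le {r : ℝ} (hr : 1 ≤ r) (u v : ℕ → ℝ≥0∞) :
    lr r (fun n => u n + v n) ≤ lr r u + lr r v := by
  have := ENNReal.lintegral_Lp_add_le (μ := Measure.count) (f := u) (g := v)
    (measurable_of_countable u).aemeasurable (measurable_of_countable v).aemeasurable hr
  simpa [lintegral_count, lr] using this

theorem lr_zero {r : ℝ} (hr : 0 < r) : lr r (fun _ => 0) = 0 := by
  simp [lr, hr]

theorem lr_sum_le {r : ℝ} (hr : 1 ≤ r) {ι : Type*} (s : Finset ι) (u : ι → ℕ → ℝ≥0∞) :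
    lr r (fun n => ∑ i ∈ s, u i n) ≤ ∑ i ∈ s, lr r (u i) := by
  classical
  induction s using Finset.induction_on with
  | empty => simp [lr_zero (zero_lt_one.trans_le hr)]
  | insert a s ha ih =>
    simp only [Finset.sum_insert ha]
    exact (lr_add_le hr _ _).trans (by gcongr)

theorem lr_const_mul {r : ℝ} (hr : 0 < r) (c : ℝ≥0∞) (u : ℕ → ℝ≥0∞) :
    lr r (fun n => c * u n) = c * lr r u := by
  unfold lr
  simp_rw [ENNReal.mul_rpow_of_nonneg _ _ hr.le]
  rw [ENNReal.tsum_mul_left, ENNReal.mul_rpow_of_nonneg _ _ (by positivity), ← ENNReal.rpow_mul,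
    mul_one_div_cancel hr.ne', ENNReal.rpow_one]

/-- Monotone convergence for `ℓ^r`; it serves to pass from finitely many dyadic levels to all of
them. -/
theorem lr_iSup {r : ℝ} (hr : 0 < r) (v : ℕ → ℕ → ℝ≥0∞) (hv : Monotone v) :
    lr r (fun n => ⨆ J, v J n) = ⨆ J, lr r (v J) := by
  have h1 : ∀ n, (⨆ J, v J n) ^ r = ⨆ J, v J n ^ r := fun n =>
    (ENNReal.orderIsoRpow r hr).map_iSup _
  have h2 : ∑' n, ⨆ J, v J n ^ r = ⨆ J, ∑' n, v J n ^ r := by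
    simp_rw [ENNReal.tsum_eq_iSup_sum]
    rw [iSup_comm]
    congr 1 with s
    refine ENNReal.finsetSum_iSup_of_monotone fun n a b hab => ?_
    exact ENNReal.rpow_le_rpow (hv hab n) hr.le
  unfold lr
  simp_rw [h1, h2]
  exact (ENNReal.orderIsoRpow (1 / r) (by positivity)).map_iSup _

theorem measurable_lr {X : Type*} [MeasurableSpace X] (r : ℝ) {u : ℕ → X → ℝ≥0∞}
    (hu : ∀ n, Measurable (u n)) : Measurable fun x => lr r fun n => u n x :=
  (Measurable.tsum fun n => (hu n).pow_const r).pow_const _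

/-- Minkowski's integral inequality, by duality: a finite part of the sequence of integrals is
tested against its own power `r - 1`. -/
theorem lr_lintegral_le {X : Type*} [MeasurableSpace X] (μ : Measure X) {r : ℝ} (hr : 1 < r)
    {u : ℕ → X → ℝ≥0∞} (hu : ∀ n, Measurable (u n)) :
    lr r (fun n => ∫⁻ x, u n x ∂μ) ≤ ∫⁻ x, lr r (fun n => u n x) ∂μ := by
  have hr0 : 0 < r := by linarith
  set U := ∫⁻ x, lr r (fun n => u n x) ∂μ with hU
  by_cases hUt : U = ∞
  · rw [hUt]; exact le_top
  set v : ℕ → ℝ≥0∞ := fun n => ∫⁻ x, u n x ∂μ with hv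
  have hvU : ∀ n, v n ≤ U := fun n => lintegral_mono fun x => le_lr hr0 (fun n => u n x) n
  have hvt : ∀ n, v n ≠ ∞ := fun n => ne_top_of_le_ne_top hUt (hvU n)
  have key : ∀ s : Finset ℕ, ∑ n ∈ s, v n ^ r ≤ U ^ r := by
    intro s
    set S := ∑ n ∈ s, v n ^ r with hS
    have hSt : S ≠ ∞ := ENNReal.sum_ne_top.2 fun n _ => ENNReal.rpow_ne_top_of_nonneg hr0.le (hvt n)
    by_cases hS0 : S = 0
    · rw [hS0]; exact zero_le
    have hpq : r.HolderConjugate (r / (r - 1)) := Real.HolderConjugate.conjExponent hr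
    set q := r / (r - 1) with hq
    have hq0 : 0 < q := hpq.symm.pos
    have hqr : (r - 1) * q = r := by
      rw [hq]; field_simp [(sub_pos.2 hr).ne']
    -- Hölder is applied pointwise under the integral. Since `(r - 1) * q = r`, the factor with the
    -- test sequence is the constant `S ^ (1 / q)`, which is cancelled below.
    have h1 : S ≤ S ^ (1 / q) * U := by
      calc S = ∑ n ∈ s, ∫⁻ x, v n ^ (r - 1) * u n x ∂μ := by
            refine Finset.sum_congr rfl fun n _ => ?_
            rw [lintegral_const_mul _ (hu n)]
            change _ = v n ^ (r - 1) * v n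
            conv_rhs => rw [← ENNReal.rpow_one (v n), ← ENNReal.rpow_mul, one_mul]
            rw [← ENNReal.rpow_add_of_nonneg _ _ (by linarith) zero_le_one]
            simp
        _ = ∫⁻ x, ∑ n ∈ s, v n ^ (r - 1) * u n x ∂μ := by
            rw [lintegral_finsetSum]
            exact fun n _ => (hu n).const_mul _
        _ ≤ ∫⁻ x, S ^ (1 / q) * lr r (fun n => u n x) ∂μ := by
            refine lintegral_mono fun x => ?_
            refine (ENNReal.inner_le_Lp_mul_Lq s _ _ hpq.symm).trans ?_
            simp_rw [← ENNReal.rpow_mul, hqr]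
            unfold lr
            gcongr
            exact ENNReal.sum_le_tsum s
        _ = S ^ (1 / q) * U := lintegral_const_mul _ (measurable_lr r hu)
    have h2 : S ^ (1 / r) ≤ U := by
      have h3 : S = S ^ (1 / q) * S ^ (1 / r) := by
        rw [← ENNReal.rpow_add _ _ hS0 hSt, one_div, one_div, add_comm, hpq.inv_add_inv_eq_one,
          ENNReal.rpow_one]
      have h4 : S ^ (1 / q) ≠ 0 := by simp [hS0, hSt, hq0]
      have h5 : S ^ (1 / q) ≠ ∞ := ENNReal.rpow_ne_top_of_nonneg (by positivity) hSt
      rw [h3] at h1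
      conv_rhs at h1 => rw [← h3]
      exact (ENNReal.mul_le_mul_iff_right h4 h5).1 h1
    calc S = (S ^ (1 / r)) ^ r := by
          rw [← ENNReal.rpow_mul, one_div_mul_cancel hr0.ne', ENNReal.rpow_one]
      _ ≤ U ^ r := ENNReal.rpow_le_rpow h2 hr0.le
  have h : lr r v ^ r ≤ U ^ r := by
    rw [lr_rpow hr0, ENNReal.tsum_eq_iSup_sum]
    exact iSup_le key
  exact (ENNReal.rpow_le_rpow_iff hr0).1 h

/-! ### Averages over the cells of a countable partition. -/

/-- The average of `u` over the fiber of `π` through `x`. -/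
noncomputable def condE {X ι : Type*} [MeasurableSpace X] (μ : Measure X) (π : X → ι)
    (u : X → ℝ≥0∞) (x : X) : ℝ≥0∞ :=
  (μ {y | π y = π x})⁻¹ * ∫⁻ y in {y | π y = π x}, u y ∂μ

section condE

variable {X ι : Type*} [MeasurableSpace X] {μ : Measure X} {π : X → ι}

theorem condE_congr {u : X → ℝ≥0∞} {x y : X} (h : π x = π y) :
    condE μ π u x = condE μ π u y := by
  simp only [condE, h]

/-- Cells of measure `0` or `∞` are harmless here: for them `(μ _)⁻¹ * μ _` is `0`. -/
theorem condE_le_const {u : X → ℝ≥0∞} {a : ℝ≥0∞} (h : ∀ x, u x ≤ a) (x : X) :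
    condE μ π u x ≤ a := by
  calc condE μ π u x ≤ (μ {y | π y = π x})⁻¹ * ∫⁻ y in {y | π y = π x}, a ∂μ := by
        unfold condE
        gcongr with y
        exact h y
    _ = a * ((μ {y | π y = π x})⁻¹ * μ {y | π y = π x}) := by
        rw [setLIntegral_const]; ring
    _ ≤ a * 1 := by gcongr; exact ENNReal.inv_mul_le_one _
    _ = a := mul_one a

theorem condE_add {u v : X → ℝ≥0∞} (hu : Measurable u) (x : X) :
    condE μ π (fun y => u y + v y) x = condE μ π u x + condE μ π v x := by
  simp only [condE]
  rw [lintegral_add_left hu, mul_add]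

theorem lr_condE_le {r : ℝ} (hr : 1 < r) {u : ℕ → X → ℝ≥0∞} (hu : ∀ n, Measurable (u n)) (x : X) :
    lr r (fun n => condE μ π (u n) x) ≤ condE μ π (fun y => lr r fun n => u n y) x := by
  simp only [condE]
  rw [lr_const_mul (by linarith)]
  gcongr
  exact lr_lintegral_le _ hr hu

theorem lintegral_fiber_condE_mul (hπ : ∀ i, MeasurableSet (π ⁻¹' {i})) (u : X → ℝ≥0∞)
    {w : X → ℝ≥0∞} (hw : Measurable w) (i : ι) :
    ∫⁻ x in π ⁻¹' {i}, condE μ π u x * w x ∂μ =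
      (μ (π ⁻¹' {i}))⁻¹ * (∫⁻ x in π ⁻¹' {i}, u x ∂μ) * ∫⁻ x in π ⁻¹' {i}, w x ∂μ := by
  rw [← lintegral_const_mul _ hw]
  refine setLIntegral_congr_fun (hπ i) fun x hx => ?_
  have hx' : π x = i := hx
  simp only [condE, hx']
  rfl

variable [Countable ι]

theorem measurable_condE (hπ : ∀ i, MeasurableSet (π ⁻¹' {i})) (u : X → ℝ≥0∞) :
    Measurable (condE μ π u) := by
  let _ : MeasurableSpace ι := ⊤
  have h1 : Measurable π := measurable_to_countable' hπ
  have h2 : Measurable fun i : ι => (μ {y | π y = i})⁻¹ * ∫⁻ y in {y | π y = i}, u y ∂μ :=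
    measurable_from_top
  exact h2.comp h1

theorem lintegral_eq_tsum_fiber (hπ : ∀ i, MeasurableSet (π ⁻¹' {i})) (g : X → ℝ≥0∞) :
    ∫⁻ x, g x ∂μ = ∑' i, ∫⁻ x in π ⁻¹' {i}, g x ∂μ := by
  rw [← lintegral_iUnion hπ, ← Set.preimage_iUnion, Set.iUnion_of_singleton, Set.preimage_univ,
    Measure.restrict_univ]
  intro i j hij
  exact Disjoint.preimage _ (by simpa using hij)

/-- Self-adjointness of averaging: on each cell both integrands integrate to the product of the
integrals of `u` and `w` divided by the measure of the cell. This replaces covering arguments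
throughout. -/
theorem lintegral_condE_mul (hπ : ∀ i, MeasurableSet (π ⁻¹' {i})) {u w : X → ℝ≥0∞}
    (hu : Measurable u) (hw : Measurable w) :
    ∫⁻ x, condE μ π u x * w x ∂μ = ∫⁻ x, u x * condE μ π w x ∂μ := by
  simp_rw [mul_comm (u _)]
  rw [lintegral_eq_tsum_fiber hπ, lintegral_eq_tsum_fiber hπ (fun x => condE μ π w x * u x)]
  congr 1 with i
  rw [lintegral_fiber_condE_mul hπ u hw, lintegral_fiber_condE_mul hπ w hu]
  ring

theorem lintegral_condE_le (hπ : ∀ i, MeasurableSet (π ⁻¹' {i})) {u : X → ℝ≥0∞}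
    (hu : Measurable u) : ∫⁻ x, condE μ π u x ∂μ ≤ ∫⁻ x, u x ∂μ := by
  have h := lintegral_condE_mul (μ := μ) hπ hu (w := fun _ => 1) measurable_const
  simp only [mul_one] at h
  rw [h]
  refine lintegral_mono fun x => ?_
  calc u x * condE μ π (fun _ => 1) x ≤ u x * 1 := by
        gcongr; exact condE_le_const (fun _ => le_rfl) x
    _ = u x := mul_one _

/-- Averaging over the fibers of `π` preserves integrals over unions of fibers. -/
theorem setLIntegral_condE (hπ : ∀ i, MeasurableSet (π ⁻¹' {i}))
    (hpos : ∀ x, μ {y | π y = π x} ≠ 0) (hfin : ∀ x, μ {y | π y = π x} ≠ ∞) {u : X → ℝ≥0∞}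
    (hu : Measurable u) {Q : Set X} (hQ : MeasurableSet Q)
    (hsat : ∀ x ∈ Q, ∀ y, π y = π x → y ∈ Q) :
    ∫⁻ x in Q, condE μ π u x ∂μ = ∫⁻ x in Q, u x ∂μ := by
  -- A union of fibers has an indicator that averaging fixes, so self-adjointness against it gives
  -- the claim.
  have h1 : ∀ x, condE μ π (Q.indicator 1) x = Q.indicator 1 x := by
    intro x
    unfold condE
    have hm : MeasurableSet {y | π y = π x} := hπ (π x)
    by_cases hx : x ∈ Q
    · rw [setLIntegral_congr_fun (g := fun _ => 1) hm]
      · simp [hx, ENNReal.inv_mul_cancel (hpos x) (hfin x)]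
      · intro y hy
        simp [hsat x hx y hy]
    · rw [setLIntegral_congr_fun (g := fun _ => 0) hm]
      · simp [hx]
      · intro y hy
        have : y ∉ Q := fun h => hx (hsat y h x hy.symm)
        simp [this]
  have h2 := lintegral_condE_mul (μ := μ) hπ hu (w := Q.indicator 1)
    (measurable_one.indicator hQ)
  simp_rw [h1] at h2
  rw [← lintegral_indicator hQ, ← lintegral_indicator hQ]
  have h3 : ∀ g : X → ℝ≥0∞, Q.indicator g = fun x => g x * Q.indicator 1 x := by
    intro g
    ext x
    by_cases hx : x ∈ Q <;> simp [hx]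
  rw [h3 (condE μ π u), h3 u]
  exact h2

end condE

/-! ### Layer-cake integrals and Marcinkiewicz interpolation. -/

theorem lintegral_rpow_Ioo {s : ℝ} (hs : 0 < s) {b : ℝ} (hb : 0 ≤ b) :
    ∫⁻ t in Set.Ioo 0 b, ENNReal.ofReal (t ^ (s - 1)) = ENNReal.ofReal (1 / s * b ^ s) := by
  have hi : IntervalIntegrable (fun t : ℝ => t ^ (s - 1)) volume 0 b :=
    intervalIntegral.intervalIntegrable_rpow' (by linarith)
  have hI := integral_rpow (a := 0) (b := b) (r := s - 1) (Or.inl (by linarith))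
  rw [sub_add_cancel, Real.zero_rpow hs.ne', sub_zero, intervalIntegral.integral_of_le hb] at hI
  rw [← restrict_Ioo_eq_restrict_Ioc] at hI
  rw [intervalIntegrable_iff_integrableOn_Ioo_of_le hb] at hi
  rw [← ofReal_integral_eq_lintegral_ofReal hi, hI]
  · congr 1; ring
  · filter_upwards [ae_restrict_mem measurableSet_Ioo] with t ht
    exact Real.rpow_nonneg ht.1.le _

theorem lintegral_rpow_Ioi {s : ℝ} (hs : 0 < s) {b : ℝ} (hb : 0 < b) :
    ∫⁻ t in Set.Ioi b, ENNReal.ofReal (t ^ (-s - 1)) = ENNReal.ofReal (1 / s * b ^ (-s)) := by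
  have hi : IntegrableOn (fun t : ℝ => t ^ (-s - 1)) (Set.Ioi b) :=
    integrableOn_Ioi_rpow_of_lt (by linarith) hb
  have hI := integral_Ioi_rpow_of_lt (a := -s - 1) (by linarith) hb
  rw [← ofReal_integral_eq_lintegral_ofReal hi, hI]
  · congr 1
    rw [sub_add_cancel]; field_simp
  · filter_upwards [ae_restrict_mem measurableSet_Ioi] with t ht
    exact Real.rpow_nonneg (hb.le.trans (le_of_lt ht)) _

theorem lintegral_ite_lt_rpow {s : ℝ} (hs : 0 < s) (a : ℝ≥0∞) :
    ∫⁻ t in Set.Ioi (0 : ℝ), (if ENNReal.ofReal t < a then ENNReal.ofReal (t ^ (s - 1)) else 0) =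
      ENNReal.ofReal (1 / s) * a ^ s := by
  have hfin : ∀ b : ℝ, 0 ≤ b → ∫⁻ t in Set.Ioi (0 : ℝ),
      (if ENNReal.ofReal t < ENNReal.ofReal b then ENNReal.ofReal (t ^ (s - 1)) else 0) =
      ENNReal.ofReal (1 / s) * ENNReal.ofReal b ^ s := by
    intro b hb
    rw [ENNReal.ofReal_rpow_of_nonneg hb hs.le, ← ENNReal.ofReal_mul (by positivity),
      ← lintegral_rpow_Ioo hs hb, ← lintegral_indicator measurableSet_Ioi,
      ← lintegral_indicator measurableSet_Ioo]
    congr 1 with t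
    by_cases h0 : 0 < t
    · by_cases h1 : t < b
      · simp [h0, h1, (ENNReal.ofReal_lt_ofReal_iff (h0.trans h1)).2 h1]
      · have : ¬ ENNReal.ofReal t < ENNReal.ofReal b :=
          not_lt.2 (ENNReal.ofReal_le_ofReal (not_lt.1 h1))
        simp [h1, this]
    · simp [h0]
  by_cases ha : a = ∞
  · subst ha
    have hr : ENNReal.ofReal (1 / s) * ∞ ^ s = ∞ := by
      rw [ENNReal.top_rpow_of_pos hs, ENNReal.mul_top (by simpa using hs)]
    rw [hr]
    -- The cutoff `(s * B) ^ (1 / s)` is the one whose truncated integral equals `B`.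
    refine ENNReal.eq_top_of_forall_nnreal_le fun B => ?_
    have h := hfin ((s * B) ^ (1 / s)) (by positivity)
    rw [ENNReal.ofReal_rpow_of_nonneg (by positivity) hs.le, ← Real.rpow_mul (by positivity),
      one_div_mul_cancel hs.ne', Real.rpow_one, ← ENNReal.ofReal_mul (by positivity),
      one_div, inv_mul_cancel_left₀ hs.ne', ENNReal.ofReal_coe_nnreal] at h
    rw [← h]
    refine lintegral_mono fun t => ?_
    simp only [ENNReal.ofReal_lt_top, if_true]
    split_ifs <;> simp
  · have := hfin a.toReal ENNReal.toReal_nonneg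
    rwa [ENNReal.ofReal_toReal ha] at this

/-- The tail integral is `a ^ (-s) / s`. The factor `a ^ r` is kept on the left because the tail
diverges at `a = 0`, where the product is still `0`; at `a = ∞` the left side vanishes and only the
inequality survives. -/
theorem lintegral_ite_le_rpow_mul {s r : ℝ} (hs : 0 < s) (hsr : s < r) (a : ℝ≥0∞) :
    (∫⁻ t in Set.Ioi (0 : ℝ),
      (if a ≤ ENNReal.ofReal t then ENNReal.ofReal (t ^ (-s - 1)) else 0)) * a ^ r ≤
      ENNReal.ofReal (1 / s) * a ^ (r - s) := by
  have hr : 0 < r := hs.trans hsr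
  by_cases ha : a = ∞
  · subst ha; simp
  by_cases ha0 : a = 0
  · subst ha0; simp [hr]
  lift a to ℝ≥0 using ha
  have hb : 0 < (a : ℝ) := by
    have : a ≠ 0 := by simpa using ha0
    exact_mod_cast pos_iff_ne_zero.2 this
  have h1 : (∫⁻ t in Set.Ioi (0 : ℝ),
      (if (a : ℝ≥0∞) ≤ ENNReal.ofReal t then ENNReal.ofReal (t ^ (-s - 1)) else 0)) =
      ENNReal.ofReal (1 / s * (a : ℝ) ^ (-s)) := by
    rw [← lintegral_rpow_Ioi hs hb, setLIntegral_congr Ioi_ae_eq_Ici,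
      setLIntegral_congr (Ioi_ae_eq_Ici (a := (a : ℝ))), ← lintegral_indicator measurableSet_Ici,
      ← lintegral_indicator measurableSet_Ici]
    congr 1 with t
    have hiff : (a : ℝ≥0∞) ≤ ENNReal.ofReal t ↔ (a : ℝ) ≤ t := by
      rw [← ENNReal.ofReal_coe_nnreal]
      by_cases ht : 0 ≤ t
      · exact ENNReal.ofReal_le_ofReal_iff ht
      · rw [ENNReal.ofReal_of_nonpos (not_le.1 ht).le]
        constructor
        · intro h
          simp at h
          linarith
        · intro h; linarith
    by_cases h : (a : ℝ) ≤ t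
    · simp [hiff, h, hb.le.trans h]
    · simp [hiff, h]
  rw [h1, ENNReal.ofReal_mul (by positivity), mul_assoc]
  gcongr
  rw [← ENNReal.ofReal_rpow_of_pos hb, ENNReal.ofReal_coe_nnreal, ← ENNReal.rpow_add _ _ ha0
    ENNReal.coe_ne_top]
  rw [show -s + r = r - s by ring]

/-- Marcinkiewicz interpolation in the form of an integrated distributional inequality. -/
theorem lintegral_rpow_le_of_distribution {X : Type*} [MeasurableSpace X] {ν σ : Measure X}
    [SFinite ν] [SFinite σ] {p r : ℝ} (hp : 1 < p) (hpr : p < r) {B u : X → ℝ≥0∞}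
    (hB : Measurable B) (hu : Measurable u) {C : ℝ≥0∞}
    (h : ∀ t : ℝ, 0 < t → ν {x | ENNReal.ofReal t < B x} ≤
      C * (ENNReal.ofReal (t ^ (-1 : ℝ)) * ∫⁻ x, (if ENNReal.ofReal t < u x then u x else 0) ∂σ +
        ENNReal.ofReal (t ^ (-r)) * ∫⁻ x, (if u x ≤ ENNReal.ofReal t then u x ^ r else 0) ∂σ)) :
    ∫⁻ x, B x ^ p ∂ν ≤ ENNReal.ofReal p *
      (C * (ENNReal.ofReal (1 / (p - 1)) + ENNReal.ofReal (1 / (r - p)))) *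
        ∫⁻ x, u x ^ p ∂σ := by
  have hp0 : 0 < p := by linarith
  have hofr : ∀ s : ℝ, Measurable fun t : ℝ => ENNReal.ofReal (t ^ s) := fun s =>
    ENNReal.measurable_ofReal.comp (measurable_id.pow_const s)
  have hlt : ∀ {f : X → ℝ≥0∞}, Measurable f →
      MeasurableSet {z : X × ℝ | ENNReal.ofReal z.2 < f z.1} := fun hf =>
    measurableSet_lt (ENNReal.measurable_ofReal.comp measurable_snd) (hf.comp measurable_fst)
  have hle : MeasurableSet {z : X × ℝ | u z.1 ≤ ENNReal.ofReal z.2} :=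
    measurableSet_le (hu.comp measurable_fst) (ENNReal.measurable_ofReal.comp measurable_snd)
  have e1 : ∫⁻ x, B x ^ p ∂ν = ENNReal.ofReal p * ∫⁻ t in Set.Ioi (0 : ℝ),
      ENNReal.ofReal (t ^ (p - 1)) * ν {x | ENNReal.ofReal t < B x} := by
    have : ∀ x, B x ^ p = ENNReal.ofReal p * ∫⁻ t in Set.Ioi (0 : ℝ),
        (if ENNReal.ofReal t < B x then ENNReal.ofReal (t ^ (p - 1)) else 0) := by
      intro x
      rw [lintegral_ite_lt_rpow hp0, ← mul_assoc, ← ENNReal.ofReal_mul hp0.le,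
        mul_one_div_cancel hp0.ne', ENNReal.ofReal_one, one_mul]
    simp_rw [this]
    have hm : Measurable (Function.uncurry fun (x : X) (t : ℝ) =>
        if ENNReal.ofReal t < B x then ENNReal.ofReal (t ^ (p - 1)) else 0) :=
      Measurable.ite (hlt hB) ((hofr _).comp measurable_snd) measurable_const
    have hm' : Measurable fun x : X => ∫⁻ t in Set.Ioi (0 : ℝ),
        (if ENNReal.ofReal t < B x then ENNReal.ofReal (t ^ (p - 1)) else 0) :=
      hm.lintegral_prod_right'
    rw [lintegral_const_mul _ hm', lintegral_lintegral_swap hm.aemeasurable]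
    congr 2 with t
    rw [← lintegral_indicator_const (measurableSet_lt measurable_const hB)]
    simp only [Set.indicator_apply, Set.mem_ofPred_eq]
  -- Tonelli: the large values of `u` contribute `u x * ∫ t ^ (p - 2)` over `0 < t < u x`, which
  -- converges at `0` because `p > 1`.
  have e2 : ∫⁻ t in Set.Ioi (0 : ℝ), ENNReal.ofReal (t ^ (p - 1)) *
      (ENNReal.ofReal (t ^ (-1 : ℝ)) * ∫⁻ x, (if ENNReal.ofReal t < u x then u x else 0) ∂σ) =
      ENNReal.ofReal (1 / (p - 1)) * ∫⁻ x, u x ^ p ∂σ := by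
    have hm : Measurable (Function.uncurry fun (t : ℝ) (x : X) =>
        (if ENNReal.ofReal t < u x then ENNReal.ofReal (t ^ (p - 1 - 1)) else 0) * u x) :=
      (Measurable.ite (measurableSet_lt (ENNReal.measurable_ofReal.comp measurable_fst)
        (hu.comp measurable_snd)) ((hofr _).comp measurable_fst) measurable_const).mul
        (hu.comp measurable_snd)
    calc _ = ∫⁻ t in Set.Ioi (0 : ℝ), ∫⁻ x,
          (if ENNReal.ofReal t < u x then ENNReal.ofReal (t ^ (p - 1 - 1)) else 0) * u x ∂σ := by
          refine setLIntegral_congr_fun measurableSet_Ioi fun t ht => ?_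
          have ht0 : (0 : ℝ) < t := ht
          rw [← mul_assoc, ← ENNReal.ofReal_mul (by positivity), ← Real.rpow_add ht0,
            ← sub_eq_add_neg, ← lintegral_const_mul]
          · congr 1 with x
            split_ifs <;> simp
          · exact Measurable.ite (measurableSet_lt measurable_const hu) hu measurable_const
      _ = ∫⁻ x, (∫⁻ t in Set.Ioi (0 : ℝ),
          (if ENNReal.ofReal t < u x then ENNReal.ofReal (t ^ (p - 1 - 1)) else 0)) * u x ∂σ := by
          rw [lintegral_lintegral_swap hm.aemeasurable]
          congr 1 with x
          rw [lintegral_mul_const]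
          exact Measurable.ite (measurableSet_lt ENNReal.measurable_ofReal measurable_const)
            (hofr _) measurable_const
      _ = _ := by
          rw [← lintegral_const_mul _ (hu.pow_const p)]
          congr 1 with x
          rw [lintegral_ite_lt_rpow (by linarith), mul_assoc]
          congr 1
          conv_lhs => rw [← ENNReal.rpow_one (u x), ← ENNReal.rpow_mul, one_mul]
          rw [← ENNReal.rpow_add_of_nonneg _ _ (by linarith) zero_le_one]
          simp
  -- The small values contribute `u x ^ r * ∫ t ^ (p - 1 - r)` over `t ≥ u x`, which converges at
  -- infinity because `p < r`.
  have e3 : ∫⁻ t in Set.Ioi (0 : ℝ), ENNReal.ofReal (t ^ (p - 1)) *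
      (ENNReal.ofReal (t ^ (-r)) * ∫⁻ x, (if u x ≤ ENNReal.ofReal t then u x ^ r else 0) ∂σ) ≤
      ENNReal.ofReal (1 / (r - p)) * ∫⁻ x, u x ^ p ∂σ := by
    have hm : Measurable (Function.uncurry fun (t : ℝ) (x : X) =>
        (if u x ≤ ENNReal.ofReal t then ENNReal.ofReal (t ^ (-(r - p) - 1)) else 0) *
          u x ^ r) :=
      (Measurable.ite (measurableSet_le (hu.comp measurable_snd)
        (ENNReal.measurable_ofReal.comp measurable_fst)) ((hofr _).comp measurable_fst)
        measurable_const).mul ((hu.comp measurable_snd).pow_const r)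
    calc _ = ∫⁻ t in Set.Ioi (0 : ℝ), ∫⁻ x,
          (if u x ≤ ENNReal.ofReal t then ENNReal.ofReal (t ^ (-(r - p) - 1)) else 0) *
            u x ^ r ∂σ := by
          refine setLIntegral_congr_fun measurableSet_Ioi fun t ht => ?_
          have ht0 : (0 : ℝ) < t := ht
          rw [← mul_assoc, ← ENNReal.ofReal_mul (by positivity), ← Real.rpow_add ht0,
            show p - 1 + -r = -(r - p) - 1 by ring, ← lintegral_const_mul]
          · congr 1 with x
            split_ifs <;> simp
          · exact Measurable.ite (measurableSet_le hu measurable_const) (hu.pow_const r)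
              measurable_const
      _ = ∫⁻ x, (∫⁻ t in Set.Ioi (0 : ℝ),
          (if u x ≤ ENNReal.ofReal t then ENNReal.ofReal (t ^ (-(r - p) - 1)) else 0)) *
            u x ^ r ∂σ := by
          rw [lintegral_lintegral_swap hm.aemeasurable]
          congr 1 with x
          rw [lintegral_mul_const]
          exact Measurable.ite (measurableSet_le measurable_const ENNReal.measurable_ofReal)
            (hofr _) measurable_const
      _ ≤ _ := by
          rw [← lintegral_const_mul _ (hu.pow_const p)]
          refine lintegral_mono fun x => ?_
          refine (lintegral_ite_le_rpow_mul (by linarith) (by linarith) (u x)).trans ?_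
          rw [sub_sub_cancel]
  rw [e1, mul_assoc]
  gcongr
  have hm2 : Measurable fun t : ℝ => ENNReal.ofReal (t ^ (p - 1)) * (ENNReal.ofReal (t ^ (-1 : ℝ)) *
      ∫⁻ x, (if ENNReal.ofReal t < u x then u x else 0) ∂σ) := by
    refine (hofr _).mul ((hofr _).mul ?_)
    exact Measurable.lintegral_prod_left' (f := fun z : X × ℝ =>
      if ENNReal.ofReal z.2 < u z.1 then u z.1 else 0)
      (Measurable.ite (hlt hu) (hu.comp measurable_fst) measurable_const)
  have hm3 : Measurable fun t : ℝ => ENNReal.ofReal (t ^ (p - 1)) * (ENNReal.ofReal (t ^ (-r)) *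
      ∫⁻ x, (if u x ≤ ENNReal.ofReal t then u x ^ r else 0) ∂σ) := by
    refine (hofr _).mul ((hofr _).mul ?_)
    exact Measurable.lintegral_prod_left' (f := fun z : X × ℝ =>
      if u z.1 ≤ ENNReal.ofReal z.2 then u z.1 ^ r else 0)
      (Measurable.ite hle ((hu.comp measurable_fst).pow_const r) measurable_const)
  calc _ ≤ ∫⁻ t in Set.Ioi (0 : ℝ), C * (ENNReal.ofReal (t ^ (p - 1)) *
        (ENNReal.ofReal (t ^ (-1 : ℝ)) * ∫⁻ x, (if ENNReal.ofReal t < u x then u x else 0) ∂σ) +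
        ENNReal.ofReal (t ^ (p - 1)) * (ENNReal.ofReal (t ^ (-r)) *
          ∫⁻ x, (if u x ≤ ENNReal.ofReal t then u x ^ r else 0) ∂σ)) := by
        refine setLIntegral_mono' measurableSet_Ioi fun t ht => ?_
        refine (mul_le_mul_right (h t ht) _).trans (le_of_eq ?_)
        ring
    _ ≤ _ := by
        refine (lintegral_const_mul _ (hm2.add hm3)).le.trans ?_
        refine (mul_le_mul_right (lintegral_add_left hm2 _).le _).trans ?_
        rw [e2, mul_assoc, add_mul]
        gcongr

/-! ### Dyadic maximal functions, stopping cells and weighted scalar inequalities. -/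

/-- A sequence of successively coarser countable measurable partitions, given by the fibers of
`c 0, c 1, …`, whose cells have positive finite measure and satisfy a doubling condition. -/
structure IsDyadic {X ι : Type*} [MeasurableSpace X] (μ : Measure X) (c : ℕ → X → ι)
    (D : ℝ≥0) : Prop where
  measurableSet_fiber : ∀ k i, MeasurableSet (c k ⁻¹' {i})
  nested : ∀ k x y, c k x = c k y → c (k + 1) x = c (k + 1) y
  ne_zero : ∀ k x, μ {y | c k y = c k x} ≠ 0
  ne_top : ∀ k x, μ {y | c k y = c k x} ≠ ∞
  doubling : ∀ k x, μ {y | c (k + 1) y = c (k + 1) x} ≤ D * μ {y | c k y = c k x}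

/-- The maximal function over the cells of level at most `N`. -/
noncomputable def dmax {X ι : Type*} [MeasurableSpace X] (μ : Measure X) (c : ℕ → X → ι) (N : ℕ)
    (u : X → ℝ≥0∞) (x : X) : ℝ≥0∞ :=
  ⨆ (k : ℕ) (_ : k ≤ N), condE μ (c k) u x

open Classical in
/-- The largest level at most `N` where the average of `u` exceeds `a`, and `0` if there is none. -/
noncomputable def stopTime {X ι : Type*} [MeasurableSpace X] (μ : Measure X) (c : ℕ → X → ι)
    (N : ℕ) (u : X → ℝ≥0∞) (a : ℝ≥0∞) (x : X) : ℕ :=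
  Nat.findGreatest (fun k => a < condE μ (c k) u x) N

/-- The partition into the stopping cells. -/
noncomputable def stopCell {X ι : Type*} [MeasurableSpace X] (μ : Measure X) (c : ℕ → X → ι)
    (N : ℕ) (u : X → ℝ≥0∞) (a : ℝ≥0∞) (x : X) : ℕ × ι :=
  (stopTime μ c N u a x, c (stopTime μ c N u a x) x)

/-- The constant in the strong type inequality for the dyadic maximal function. -/
noncomputable def strongConst (r : ℝ) : ℝ≥0∞ :=
  2 ^ r * (ENNReal.ofReal r * (ENNReal.ofReal (1 / (r - 1)) + 1))

theorem strongConst_ne_top {r : ℝ} (hr : 0 ≤ r) : strongConst r ≠ ∞ := by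
  unfold strongConst
  have : (2 : ℝ≥0∞) ^ r ≠ ∞ := ENNReal.rpow_ne_top_of_nonneg hr ENNReal.ofNat_ne_top
  finiteness

section dyadic

variable {X ι : Type*} [MeasurableSpace X] {μ : Measure X} {c : ℕ → X → ι} {D : ℝ≥0} {N : ℕ}

theorem condE_le_dmax {k : ℕ} (hk : k ≤ N) (u : X → ℝ≥0∞) (x : X) :
    condE μ (c k) u x ≤ dmax μ c N u x :=
  le_iSup₂_of_le k hk le_rfl

theorem dmax_add_le {u v : X → ℝ≥0∞} (hu : Measurable u) (x : X) :
    dmax μ c N (fun y => u y + v y) x ≤ dmax μ c N u x + dmax μ c N v x := by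
  refine iSup₂_le fun k hk => ?_
  rw [condE_add hu]
  exact add_le_add (condE_le_dmax hk u x) (condE_le_dmax hk v x)

theorem dmax_le_const {u : X → ℝ≥0∞} {a : ℝ≥0∞} (h : ∀ x, u x ≤ a) (x : X) :
    dmax μ c N u x ≤ a :=
  iSup₂_le fun _ _ => condE_le_const h x

theorem condE_stopTime_of_lt {u : X → ℝ≥0∞} {a : ℝ≥0∞} {x : X} (h : a < dmax μ c N u x) :
    a < condE μ (c (stopTime μ c N u a x)) u x := by
  classical
  simp only [dmax, lt_iSup_iff] at h
  obtain ⟨k, hk, h⟩ := h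
  unfold stopTime
  exact Nat.findGreatest_spec (P := fun k => a < condE μ (c k) u x) hk h

theorem stopTime_le (u : X → ℝ≥0∞) (a : ℝ≥0∞) (x : X) : stopTime μ c N u a x ≤ N := by
  classical
  unfold stopTime
  exact Nat.findGreatest_le N

theorem condE_le_of_stopTime_lt {u : X → ℝ≥0∞} {a : ℝ≥0∞} {x : X} {k : ℕ}
    (h : stopTime μ c N u a x < k) (hk : k ≤ N) : condE μ (c k) u x ≤ a := by
  classical
  unfold stopTime at h
  exact not_lt.1 (Nat.findGreatest_is_greatest h hk)

theorem stopTime_le_of_forall {u : X → ℝ≥0∞} {a : ℝ≥0∞} {x : X} {k : ℕ}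
    (h : ∀ j, k < j → j ≤ N → condE μ (c j) u x ≤ a) : stopTime μ c N u a x ≤ k := by
  classical
  by_contra! hlt
  have h1 := h _ hlt (stopTime_le u a x)
  have h2 : a < condE μ (c (stopTime μ c N u a x)) u x := by
    unfold stopTime at hlt ⊢
    exact Nat.findGreatest_of_ne_zero (m := Nat.findGreatest (fun k => a < condE μ (c k) u x) N)
      rfl (by omega)
  exact absurd h2 (not_lt.2 h1)

namespace IsDyadic

theorem eq_of_le (hc : IsDyadic μ c D) {j k : ℕ} (hjk : j ≤ k) {x y : X} (h : c j x = c j y) :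
    c k x = c k y := by
  induction k, hjk using Nat.le_induction with
  | base => exact h
  | succ k _ ih => exact hc.nested k x y ih

/-- The stopping rule at level `k` only looks at cells of level `k` and coarser, and by nesting
these are the same for all points of the stopping cell. -/
theorem stopTime_eq (hc : IsDyadic μ c D) {u : X → ℝ≥0∞} {a : ℝ≥0∞} {x y : X}
    (h : c (stopTime μ c N u a x) y = c (stopTime μ c N u a x) x) :
    stopTime μ c N u a y = stopTime μ c N u a x := by
  have hle : stopTime μ c N u a y ≤ stopTime μ c N u a x := by
    refine stopTime_le_of_forall fun j hj hjN => ?_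
    rw [condE_congr (hc.eq_of_le hj.le h)]
    exact condE_le_of_stopTime_lt hj hjN
  -- If `y` stopped strictly earlier, the common average at the stopping level of `x` would be at
  -- most `a`, so `x` would already stop one level lower. That level is positive here, so
  -- subtracting `1` is not truncated.
  refine le_antisymm hle ?_
  by_contra! hlt
  have h1 := condE_le_of_stopTime_lt hlt (stopTime_le u a x)
  rw [condE_congr h] at h1
  have h2 : stopTime μ c N u a x ≤ stopTime μ c N u a x - 1 := by
    refine stopTime_le_of_forall fun j hj hjN => ?_
    rcases Nat.lt_or_ge (stopTime μ c N u a x) j with h3 | h3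
    · exact condE_le_of_stopTime_lt h3 hjN
    · have : j = stopTime μ c N u a x := by omega
      rw [this]
      exact h1
  omega

/-- The stopping partition consists of cells of the original partitions, so their measure bounds
carry over to it. -/
theorem stopCell_fiber (hc : IsDyadic μ c D) (u : X → ℝ≥0∞) (a : ℝ≥0∞) (x : X) :
    {y | stopCell μ c N u a y = stopCell μ c N u a x} =
      {y | c (stopTime μ c N u a x) y = c (stopTime μ c N u a x) x} := by
  ext y
  simp only [stopCell, Prod.mk.injEq, Set.mem_ofPred_eq]
  constructor
  · rintro ⟨h1, h2⟩
    rwa [h1] at h2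
  · intro h
    have := hc.stopTime_eq h
    rw [this]
    exact ⟨rfl, h⟩

theorem condE_stopCell (hc : IsDyadic μ c D) (u v : X → ℝ≥0∞) (a : ℝ≥0∞) (x : X) :
    condE μ (stopCell μ c N u a) v x = condE μ (c (stopTime μ c N u a x)) v x := by
  simp only [condE, hc.stopCell_fiber]

theorem condE_le_mul (hc : IsDyadic μ c D) (u : X → ℝ≥0∞) (k : ℕ) (x : X) :
    condE μ (c k) u x ≤ D * condE μ (c (k + 1)) u x := by
  have hsub : {y | c k y = c k x} ⊆ {y | c (k + 1) y = c (k + 1) x} := fun y hy =>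
    hc.nested k y x hy
  have hinv : (μ {y | c k y = c k x})⁻¹ ≤ D * (μ {y | c (k + 1) y = c (k + 1) x})⁻¹ := by
    rw [← div_eq_mul_inv, ENNReal.le_div_iff_mul_le (Or.inl (hc.ne_zero _ _))
      (Or.inl (hc.ne_top _ _)), mul_comm, ← div_eq_mul_inv]
    exact ENNReal.div_le_of_le_mul (hc.doubling k x)
  calc condE μ (c k) u x ≤ (D * (μ {y | c (k + 1) y = c (k + 1) x})⁻¹) *
        ∫⁻ y in {y | c (k + 1) y = c (k + 1) x}, u y ∂μ := by
        unfold condE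
        gcongr
    _ = _ := by rw [condE, mul_assoc]

variable [Countable ι]

theorem measurable_condE (hc : IsDyadic μ c D) (k : ℕ) (u : X → ℝ≥0∞) :
    Measurable (condE μ (c k) u) :=
  Dunkl.measurable_condE (hc.measurableSet_fiber k) u

theorem measurable_dmax (hc : IsDyadic μ c D) (u : X → ℝ≥0∞) : Measurable (dmax μ c N u) :=
  Measurable.iSup fun k => Measurable.iSup fun _ => hc.measurable_condE k u

theorem measurable_stopTime (hc : IsDyadic μ c D) (u : X → ℝ≥0∞) (a : ℝ≥0∞) :
    Measurable (stopTime μ c N u a) := by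
  classical
  unfold stopTime
  exact measurable_findGreatest fun k _ =>
    measurableSet_lt measurable_const (hc.measurable_condE k u)

theorem measurableSet_stopCell_fiber (hc : IsDyadic μ c D) (u : X → ℝ≥0∞) (a : ℝ≥0∞) (i : ℕ × ι) :
    MeasurableSet (stopCell μ c N u a ⁻¹' {i}) := by
  have : stopCell μ c N u a ⁻¹' {i} = stopTime μ c N u a ⁻¹' {i.1} ∩ c i.1 ⁻¹' {i.2} := by
    ext x
    simp only [stopCell, Set.mem_preimage, Set.mem_singleton_iff, Set.mem_inter_iff, Prod.ext_iff]
    constructor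
    · rintro ⟨h1, h2⟩
      exact ⟨h1, h1 ▸ h2⟩
    · rintro ⟨h1, h2⟩
      exact ⟨h1, by rw [h1]; exact h2⟩
  rw [this]
  exact (hc.measurable_stopTime u a (measurableSet_singleton _)).inter
    (hc.measurableSet_fiber _ _)

/-- The weighted weak type inequality, with the maximal function of the weight on the right. -/
theorem mul_setLIntegral_dmax_le (hc : IsDyadic μ c D) {u w : X → ℝ≥0∞} (hu : Measurable u)
    (hw : Measurable w) (a : ℝ≥0∞) :
    a * ∫⁻ x in {x | a < dmax μ c N u x}, w x ∂μ ≤ ∫⁻ x, u x * dmax μ c N w x ∂μ := by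
  have hE : MeasurableSet {x | a < dmax μ c N u x} :=
    measurableSet_lt measurable_const (hc.measurable_dmax u)
  set E := {x | a < dmax μ c N u x} with hEdef
  have hπ := hc.measurableSet_stopCell_fiber (N := N) u a
  -- On `E` the average of `u` over the stopping cell exceeds `a`; self-adjointness then moves the
  -- averaging onto `w`, where it is at most the maximal function.
  calc a * ∫⁻ x in E, w x ∂μ = ∫⁻ x in E, a * w x ∂μ := (lintegral_const_mul _ hw).symm
    _ ≤ ∫⁻ x in E, condE μ (stopCell μ c N u a) u x * w x ∂μ := by
        refine setLIntegral_mono' hE fun x hx => ?_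
        gcongr
        rw [hc.condE_stopCell]
        exact (condE_stopTime_of_lt hx).le
    _ ≤ ∫⁻ x, condE μ (stopCell μ c N u a) u x * w x ∂μ := setLIntegral_le_lintegral _ _
    _ = ∫⁻ x, u x * condE μ (stopCell μ c N u a) w x ∂μ := lintegral_condE_mul hπ hu hw
    _ ≤ _ := by
        refine lintegral_mono fun x => ?_
        gcongr
        rw [hc.condE_stopCell]
        exact condE_le_dmax (stopTime_le u a x) w x

theorem mul_measure_dmax_le (hc : IsDyadic μ c D) {u : X → ℝ≥0∞} (hu : Measurable u) (a : ℝ≥0∞) :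
    a * μ {x | a < dmax μ c N u x} ≤ ∫⁻ x, u x ∂μ := by
  have h := hc.mul_setLIntegral_dmax_le (N := N) hu (w := fun _ => 1) measurable_const a
  rw [setLIntegral_const, one_mul] at h
  refine h.trans (lintegral_mono fun x => ?_)
  calc u x * dmax μ c N (fun _ => 1) x ≤ u x * 1 := by
        gcongr; exact dmax_le_const (fun _ => le_rfl) x
    _ = u x := mul_one _

/-- The weighted strong type inequality, with the maximal function of the weight on the right. -/
theorem lintegral_dmax_rpow_mul_le [SFinite μ] (hc : IsDyadic μ c D) {r : ℝ} (hr : 1 < r)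
    {u w : X → ℝ≥0∞} (hu : Measurable u) (hw : Measurable w) :
    ∫⁻ x, dmax μ c N u x ^ r * w x ∂μ ≤
      strongConst r * ∫⁻ x, u x ^ r * dmax μ c N w x ∂μ := by
  have hMw := hc.measurable_dmax (N := N) w
  have hMu := hc.measurable_dmax (N := N) u
  -- Any upper exponent above `r` would do, since only the weak type term is needed; `r + 1` makes
  -- its constant `1`. The division by `2` pays for splitting `u` at height `t`.
  have h := lintegral_rpow_le_of_distribution (ν := μ.withDensity w)
    (σ := μ.withDensity (dmax μ c N w)) hr (lt_add_one r)
    (B := fun x => dmax μ c N u x / 2) (u := u) (hMu.div_const 2) hu (C := 1) ?_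
  · rw [lintegral_withDensity_eq_lintegral_mul _ hw ((hMu.div_const 2).pow_const r),
      lintegral_withDensity_eq_lintegral_mul _ hMw (hu.pow_const r)] at h
    simp only [Pi.mul_apply, one_mul, add_sub_cancel_left, div_one, ENNReal.ofReal_one] at h
    calc ∫⁻ x, dmax μ c N u x ^ r * w x ∂μ
        = 2 ^ r * ∫⁻ x, w x * (dmax μ c N u x / 2) ^ r ∂μ := by
          refine Eq.trans ?_ (lintegral_const_mul _ (hw.mul ((hMu.div_const 2).pow_const r)))
          congr 1 with x
          rw [mul_comm (w x), ← mul_assoc, ← ENNReal.mul_rpow_of_nonneg _ _ (by linarith),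
            ENNReal.mul_div_cancel two_ne_zero ENNReal.ofNat_ne_top]
      _ ≤ _ := by
          rw [strongConst, mul_assoc (2 ^ r)]
          simp_rw [mul_comm (u _ ^ r)]
          gcongr
  · intro t ht
    set b := ENNReal.ofReal t with hb
    have hb0 : b ≠ 0 := by simpa [hb] using ht
    have hbt : b ≠ ∞ := ENNReal.ofReal_ne_top
    set u₁ : X → ℝ≥0∞ := fun x => if b < u x then u x else 0 with hu₁
    set u₂ : X → ℝ≥0∞ := fun x => if b < u x then 0 else u x with hu₂
    have hbu : MeasurableSet {x | b < u x} := measurableSet_lt measurable_const hu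
    have hm₁ : Measurable u₁ := Measurable.ite hbu hu measurable_const
    have hsum : u = fun x => u₁ x + u₂ x := by
      ext x
      simp only [hu₁, hu₂]
      split_ifs <;> simp
    have hu₂b : ∀ x, u₂ x ≤ b := by
      intro x
      simp only [hu₂]
      split_ifs with hx
      · exact zero_le
      · exact not_lt.1 hx
    have hsub : {x | b < dmax μ c N u x / 2} ⊆ {x | b < dmax μ c N u₁ x} := by
      intro x hx
      have hx' : b * 2 < dmax μ c N u x :=
        (ENNReal.lt_div_iff_mul_lt (Or.inl two_ne_zero) (Or.inl ENNReal.ofNat_ne_top)).1 hx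
      by_contra hx1
      have hx1' : dmax μ c N u₁ x ≤ b := not_lt.1 hx1
      have := dmax_add_le (μ := μ) (c := c) (N := N) (v := u₂) hm₁ x
      rw [← hsum] at this
      refine absurd hx' (not_lt.2 (this.trans ?_))
      rw [mul_two]
      exact add_le_add hx1' (dmax_le_const hu₂b x)
    have hw1 := hc.mul_setLIntegral_dmax_le (N := N) hm₁ hw b
    have hmeas : MeasurableSet {x | b < dmax μ c N u₁ x} :=
      measurableSet_lt measurable_const (hc.measurable_dmax _)
    have hinv : ENNReal.ofReal (t ^ (-1 : ℝ)) = b⁻¹ := by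
      rw [Real.rpow_neg_one, ENNReal.ofReal_inv_of_pos ht]
    rw [one_mul]
    -- The part of `u` below height `t` has maximal function at most `t` and contributes nothing, so
    -- the second term is dropped.
    refine le_trans ?_ le_self_add
    rw [hinv]
    calc μ.withDensity w {x | b < dmax μ c N u x / 2}
        ≤ μ.withDensity w {x | b < dmax μ c N u₁ x} := measure_mono hsub
      _ = ∫⁻ x in {x | b < dmax μ c N u₁ x}, w x ∂μ := withDensity_apply _ hmeas
      _ ≤ b⁻¹ * ∫⁻ x, u₁ x * dmax μ c N w x ∂μ := by
          rw [mul_comm, ← div_eq_mul_inv, ENNReal.le_div_iff_mul_le (Or.inl hb0) (Or.inl hbt),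
            mul_comm]
          exact hw1
      _ = _ := by
          rw [lintegral_withDensity_eq_lintegral_mul _ hMw hm₁]
          simp_rw [Pi.mul_apply, mul_comm]

end IsDyadic

end dyadic

/-! ### Vector-valued inequalities for finitely many levels. -/

namespace IsDyadic

variable {X ι : Type*} [MeasurableSpace X] {μ : Measure X} {c : ℕ → X → ι} {D : ℝ≥0} {N : ℕ}

/-- Off the set where the maximal function of `F` exceeds `a`, maximal functions do not change
under averaging over the stopping cells of `F` and deletion of the top cells among them. -/
theorem dmax_stopped [Countable ι] (hc : IsDyadic μ c D) {F u : X → ℝ≥0∞} (hu : Measurable u)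
    {a : ℝ≥0∞} {x : X} (hx : dmax μ c N F x ≤ a) :
    dmax μ c N ({y | condE μ (c N) F y ≤ a}.indicator (condE μ (stopCell μ c N F a) u)) x =
      dmax μ c N u x := by
  refine iSup_congr fun k => iSup_congr fun hk => ?_
  have hQ : MeasurableSet {y | c k y = c k x} := hc.measurableSet_fiber k (c k x)
  -- Averages of `F` over the cell of `x` at level `k` and over all coarser ones are at most `a`.
  -- Hence the indicator is `1` on that cell, and a stopping cell that meets it lies inside it.
  have hle : ∀ y, c k y = c k x → ∀ j, k ≤ j → j ≤ N → condE μ (c j) F y ≤ a := by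
    intro y hy j hkj hj
    rw [condE_congr (hc.eq_of_le hkj hy)]
    exact (condE_le_dmax hj F x).trans hx
  have h1 : ∫⁻ y in {y | c k y = c k x},
      {y | condE μ (c N) F y ≤ a}.indicator (condE μ (stopCell μ c N F a) u) y ∂μ =
      ∫⁻ y in {y | c k y = c k x}, condE μ (stopCell μ c N F a) u y ∂μ := by
    refine setLIntegral_congr_fun hQ fun y hy => ?_
    exact Set.indicator_of_mem (s := {y | condE μ (c N) F y ≤ a}) (hle y hy N hk le_rfl) _
  unfold condE at h1 ⊢
  rw [h1]
  congr 1
  refine setLIntegral_condE (hc.measurableSet_stopCell_fiber F a) ?_ ?_ hu hQ ?_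
  · intro y
    rw [hc.stopCell_fiber]
    exact hc.ne_zero _ _
  · intro y
    rw [hc.stopCell_fiber]
    exact hc.ne_top _ _
  · intro y hy z hz
    have hz' : z ∈ {z | stopCell μ c N F a z = stopCell μ c N F a y} := hz
    rw [hc.stopCell_fiber] at hz'
    have hτ : stopTime μ c N F a y ≤ k :=
      stopTime_le_of_forall fun j hj hjN => hle y hy j hj.le hjN
    exact (hc.eq_of_le hτ hz').trans hy

/-- A stopping cell below the top level has a parent with average at most `a`, and doubling costs
the factor `D`. A top cell has no parent to compare with, so there the bound is the hypothesis; the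
`+ 1` covers this case. -/
theorem condE_stopCell_le (hc : IsDyadic μ c D) {F : X → ℝ≥0∞} {a : ℝ≥0∞} {x : X}
    (hx : condE μ (c N) F x ≤ a) : condE μ (stopCell μ c N F a) F x ≤ (D + 1) * a := by
  rw [hc.condE_stopCell]
  rcases (stopTime_le (μ := μ) (c := c) (N := N) F a x).lt_or_eq with h | h
  · refine (hc.condE_le_mul F _ x).trans ?_
    gcongr
    · exact le_self_add
    · exact condE_le_of_stopTime_lt (Nat.lt_succ_self _) h
  · rw [h]
    calc _ ≤ 1 * a := by rwa [one_mul]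
      _ ≤ _ := by gcongr; exact le_add_self

variable [Countable ι]

/-- The power `r` matches the exponent of `ℓ^r`, so the scalar weighted inequality sums term by
term. -/
theorem lintegral_lr_dmax_rpow_mul_le [SFinite μ] (hc : IsDyadic μ c D) {r : ℝ} (hr : 1 < r)
    {U : ℕ → X → ℝ≥0∞} (hU : ∀ n, Measurable (U n)) {w : X → ℝ≥0∞} (hw : Measurable w) :
    ∫⁻ x, lr r (fun n => dmax μ c N (U n) x) ^ r * w x ∂μ ≤
      strongConst r * ∫⁻ x, lr r (fun n => U n x) ^ r * dmax μ c N w x ∂μ := by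
  have hr0 : 0 < r := by linarith
  simp_rw [lr_rpow hr0, ← ENNReal.tsum_mul_right]
  rw [lintegral_tsum (f := fun n x => dmax μ c N (U n) x ^ r * w x)
      fun n => (((hc.measurable_dmax (U n)).pow_const r).mul hw).aemeasurable,
    lintegral_tsum (f := fun n x => U n x ^ r * dmax μ c N w x)
      fun n => (((hU n).pow_const r).mul (hc.measurable_dmax w)).aemeasurable,
    ← ENNReal.tsum_mul_left]
  exact ENNReal.tsum_le_tsum fun n => hc.lintegral_dmax_rpow_mul_le hr (hU n) hw

theorem lintegral_lr_dmax_rpow_self_le [SFinite μ] (hc : IsDyadic μ c D) {r : ℝ} (hr : 1 < r)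
    {U : ℕ → X → ℝ≥0∞} (hU : ∀ n, Measurable (U n)) :
    ∫⁻ x, lr r (fun n => dmax μ c N (U n) x) ^ r ∂μ ≤
      strongConst r * ∫⁻ x, lr r (fun n => U n x) ^ r ∂μ := by
  have h := hc.lintegral_lr_dmax_rpow_mul_le (N := N) hr hU (w := fun _ => 1) measurable_const
  simp_rw [mul_one] at h
  refine h.trans ?_
  gcongr with x
  calc _ ≤ lr r (fun n => U n x) ^ r * 1 := by
        gcongr; exact dmax_le_const (fun _ => le_rfl) x
    _ = _ := mul_one _

/-- A Calderón–Zygmund argument in which the bad part disappears: off `{MF > a}` the maximal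
functions of the `U n` and of their stopped averages `g n` agree. By Minkowski the `ℓ^r` norm of `g`
is at most the stopped average of `F`, and it is also at most `(D + 1) * a`. This bounds its `r`-th
power integral by the integral of `F`, and the case `p = r` with Chebyshev finishes. -/
theorem mul_measure_lr_dmax_le [SFinite μ] (hc : IsDyadic μ c D) {r : ℝ} (hr : 1 < r)
    {U : ℕ → X → ℝ≥0∞} (hU : ∀ n, Measurable (U n)) {a : ℝ≥0∞} (ha0 : a ≠ 0) (ha : a ≠ ∞) :
    a * μ {x | a < lr r (fun n => dmax μ c N (U n) x)} ≤
      (1 + strongConst r * (D + 1) ^ (r - 1)) * ∫⁻ x, lr r (fun n => U n x) ∂μ := by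
  have hr0 : 0 < r := by linarith
  set F : X → ℝ≥0∞ := fun x => lr r (fun n => U n x) with hF
  have hFm : Measurable F := measurable_lr r hU
  set G : Set X := {y | condE μ (c N) F y ≤ a} with hG
  have hGm : MeasurableSet G := measurableSet_le (hc.measurable_condE N F) measurable_const
  set π := stopCell μ c N F a with hπ
  have hπm := hc.measurableSet_stopCell_fiber (N := N) F a
  set g : ℕ → X → ℝ≥0∞ := fun n => G.indicator (condE μ π (U n)) with hg
  have hgm : ∀ n, Measurable (g n) := fun n => (Dunkl.measurable_condE hπm _).indicator hGm
  have hgF : ∀ x, lr r (fun n => g n x) ≤ condE μ π F x := fun x =>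
    (lr_mono hr0 fun n => Set.indicator_le_self G (condE μ π (U n)) x).trans (lr_condE_le hr hU x)
  have hgD : ∀ x, lr r (fun n => g n x) ≤ (D + 1) * a := by
    intro x
    by_cases hx : x ∈ G
    · exact (hgF x).trans (hc.condE_stopCell_le hx)
    · have : (fun n => g n x) = fun _ => 0 := by
        ext n
        simp [hg, hx]
      rw [this, lr_zero hr0]
      exact zero_le
  have hsub : {x | a < lr r (fun n => dmax μ c N (U n) x)} ⊆
      {x | a < dmax μ c N F x} ∪ {x | a < lr r (fun n => dmax μ c N (g n) x)} := by
    intro x hx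
    by_cases hxE : a < dmax μ c N F x
    · exact Or.inl hxE
    · refine Or.inr ?_
      have : ∀ n, dmax μ c N (g n) x = dmax μ c N (U n) x := fun n =>
        hc.dmax_stopped (hU n) (not_lt.1 hxE)
      simp only [Set.mem_ofPred_eq, this]
      exact hx
  have hgr : ∫⁻ x, lr r (fun n => g n x) ^ r ∂μ ≤ ((D + 1) * a) ^ (r - 1) * ∫⁻ x, F x ∂μ := by
    calc _ ≤ ∫⁻ x, ((D + 1) * a) ^ (r - 1) * condE μ π F x ∂μ := by
          refine lintegral_mono fun x => ?_
          calc lr r (fun n => g n x) ^ r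
              = lr r (fun n => g n x) ^ (r - 1) * lr r (fun n => g n x) := by
                conv_rhs => rw [← ENNReal.rpow_one (lr r fun n => g n x), ← ENNReal.rpow_mul,
                  one_mul]
                rw [← ENNReal.rpow_add_of_nonneg _ _ (by linarith) zero_le_one]
                simp
            _ ≤ _ := mul_le_mul' (ENNReal.rpow_le_rpow (hgD x) (by linarith)) (hgF x)
      _ = ((D + 1) * a) ^ (r - 1) * ∫⁻ x, condE μ π F x ∂μ :=
          lintegral_const_mul _ (Dunkl.measurable_condE hπm _)
      _ ≤ _ := mul_le_mul_right (lintegral_condE_le hπm hFm) _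
  have hA := hc.lintegral_lr_dmax_rpow_self_le (N := N) hr hgm
  have hAm : Measurable fun x => lr r (fun n => dmax μ c N (g n) x) :=
    measurable_lr r fun n => hc.measurable_dmax (g n)
  have hbad : a * μ {x | a < lr r (fun n => dmax μ c N (g n) x)} ≤
      strongConst r * (D + 1) ^ (r - 1) * ∫⁻ x, F x ∂μ := by
    have hpos : a ^ (r - 1) ≠ 0 := by simp [ha0, ha, hr]
    have hfin : a ^ (r - 1) ≠ ∞ := ENNReal.rpow_ne_top_of_nonneg (by linarith) ha
    -- Chebyshev produces `a ^ r` while the bound on `g` produces `a ^ (r - 1)`; the common power is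
    -- cancelled, which needs `0 < a < ∞`.
    refine (ENNReal.mul_le_mul_iff_right hpos hfin).1 ?_
    calc _ = a ^ r * μ {x | a < lr r (fun n => dmax μ c N (g n) x)} := by
          rw [← mul_assoc]
          congr 1
          conv_lhs => rw [← ENNReal.rpow_one a, ← ENNReal.rpow_mul, one_mul]
          rw [← ENNReal.rpow_add_of_nonneg _ _ (by linarith) zero_le_one]
          simp
      _ ≤ a ^ r * μ {x | a ^ r ≤ lr r (fun n => dmax μ c N (g n) x) ^ r} := by
          gcongr 2
          intro x hx
          exact ENNReal.rpow_le_rpow (le_of_lt hx) hr0.le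
      _ ≤ ∫⁻ x, lr r (fun n => dmax μ c N (g n) x) ^ r ∂μ :=
          mul_meas_ge_le_lintegral (hAm.pow_const r) _
      _ ≤ strongConst r * (((D + 1) * a) ^ (r - 1) * ∫⁻ x, F x ∂μ) := by
          refine hA.trans ?_
          gcongr
      _ = _ := by
          rw [ENNReal.mul_rpow_of_nonneg _ _ (by linarith)]
          ring
  calc a * μ {x | a < lr r (fun n => dmax μ c N (U n) x)}
      ≤ a * (μ {x | a < dmax μ c N F x} + μ {x | a < lr r (fun n => dmax μ c N (g n) x)}) := by
        gcongr
        exact (measure_mono hsub).trans (measure_union_le _ _)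
    _ ≤ ∫⁻ x, F x ∂μ + strongConst r * (D + 1) ^ (r - 1) * ∫⁻ x, F x ∂μ := by
        rw [mul_add]
        exact add_le_add (hc.mul_measure_dmax_le hFm a) hbad
    _ = _ := by ring

/-- Interpolation between weak type `1` and strong type `r`. All `U n` are cut simultaneously,
according to the size of their `ℓ^r` norm `F`, so that the norms of the two pieces are the
truncations of `F`. -/
theorem lintegral_lr_dmax_rpow_le_of_lt [SFinite μ] (hc : IsDyadic μ c D) {p r : ℝ} (hp : 1 < p)
    (hpr : p < r) {U : ℕ → X → ℝ≥0∞} (hU : ∀ n, Measurable (U n)) :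
    ∫⁻ x, lr r (fun n => dmax μ c N (U n) x) ^ p ∂μ ≤
      2 ^ p * (ENNReal.ofReal p * (((1 + strongConst r * (D + 1) ^ (r - 1)) + strongConst r) *
        (ENNReal.ofReal (1 / (p - 1)) + ENNReal.ofReal (1 / (r - p))))) *
        ∫⁻ x, lr r (fun n => U n x) ^ p ∂μ := by
  have hr : 1 < r := hp.trans hpr
  have hr0 : 0 < r := by linarith
  set A : X → ℝ≥0∞ := fun x => lr r (fun n => dmax μ c N (U n) x) with hAdef
  have hA : Measurable A := measurable_lr r fun n => hc.measurable_dmax (U n)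
  set F : X → ℝ≥0∞ := fun x => lr r (fun n => U n x) with hF
  have hFm : Measurable F := measurable_lr r hU
  have h := lintegral_rpow_le_of_distribution (ν := μ) (σ := μ) hp hpr
    (B := fun x => A x / 2) (u := F) (hA.div_const 2) hFm
    (C := (1 + strongConst r * (D + 1) ^ (r - 1)) + strongConst r) ?_
  · calc ∫⁻ x, A x ^ p ∂μ = 2 ^ p * ∫⁻ x, (A x / 2) ^ p ∂μ := by
          rw [← lintegral_const_mul _ ((hA.div_const 2).pow_const p)]
          congr 1 with x
          rw [← ENNReal.mul_rpow_of_nonneg _ _ (by linarith),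
            ENNReal.mul_div_cancel two_ne_zero ENNReal.ofNat_ne_top]
      _ ≤ _ := by
          rw [mul_assoc (2 ^ p)]
          gcongr
  · intro t ht
    set b := ENNReal.ofReal t with hb
    have hb0 : b ≠ 0 := by simpa [hb] using ht
    have hbt : b ≠ ∞ := ENNReal.ofReal_ne_top
    have hS : MeasurableSet {x | b < F x} := measurableSet_lt measurable_const hFm
    set U₁ : ℕ → X → ℝ≥0∞ := fun n x => if b < F x then U n x else 0 with hU₁
    set U₂ : ℕ → X → ℝ≥0∞ := fun n x => if F x ≤ b then U n x else 0 with hU₂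
    have hm₁ : ∀ n, Measurable (U₁ n) := fun n => Measurable.ite hS (hU n) measurable_const
    have hm₂ : ∀ n, Measurable (U₂ n) := fun n =>
      Measurable.ite (measurableSet_le hFm measurable_const) (hU n) measurable_const
    have hsum : ∀ n, U n = fun x => U₁ n x + U₂ n x := by
      intro n
      ext x
      simp only [hU₁, hU₂]
      rcases lt_or_ge b (F x) with h | h
      · simp [h, not_le.2 h]
      · simp [h, not_lt.2 h]
    have hF₁ : ∀ x, lr r (fun n => U₁ n x) = if b < F x then F x else 0 := by
      intro x
      split_ifs with h
      · have : (fun n => U₁ n x) = fun n => U n x := by ext n; exact if_pos h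
        rw [this]
      · have : (fun n => U₁ n x) = fun n => 0 := by ext n; exact if_neg h
        rw [this, lr_zero hr0]
    have hF₂ : ∀ x, lr r (fun n => U₂ n x) ^ r = if F x ≤ b then F x ^ r else 0 := by
      intro x
      split_ifs with h
      · have : (fun n => U₂ n x) = fun n => U n x := by ext n; exact if_pos h
        rw [this]
      · have : (fun n => U₂ n x) = fun n => 0 := by ext n; exact if_neg h
        rw [this, lr_zero hr0, ENNReal.zero_rpow_of_pos hr0]
    have hsub : {x | b < A x / 2} ⊆ {x | b < lr r (fun n => dmax μ c N (U₁ n) x)} ∪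
        {x | b < lr r (fun n => dmax μ c N (U₂ n) x)} := by
      intro x hx
      have hx' : b * 2 < A x :=
        (ENNReal.lt_div_iff_mul_lt (Or.inl two_ne_zero) (Or.inl ENNReal.ofNat_ne_top)).1 hx
      by_contra hcon
      simp only [Set.mem_union, Set.mem_ofPred_eq, not_or, not_lt] at hcon
      refine absurd hx' (not_lt.2 ?_)
      rw [mul_two]
      refine le_trans ?_ (add_le_add hcon.1 hcon.2)
      refine le_trans (lr_mono hr0 fun n => ?_) (lr_add_le hr.le _ _)
      conv_lhs => rw [hsum n]
      exact dmax_add_le (hm₁ n) x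
    have h1 := hc.mul_measure_lr_dmax_le (N := N) hr hm₁ hb0 hbt
    have h2 := hc.lintegral_lr_dmax_rpow_self_le (N := N) hr hm₂
    simp_rw [hF₁] at h1
    simp_rw [hF₂] at h2
    have hAm : Measurable fun x => lr r (fun n => dmax μ c N (U₂ n) x) :=
      measurable_lr r fun n => hc.measurable_dmax (U₂ n)
    have hbr0 : b ^ r ≠ 0 := by simp [hb0, hbt]
    have hbrt : b ^ r ≠ ∞ := ENNReal.rpow_ne_top_of_nonneg hr0.le hbt
    have hinv1 : ENNReal.ofReal (t ^ (-1 : ℝ)) = b⁻¹ := by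
      rw [Real.rpow_neg_one, ENNReal.ofReal_inv_of_pos ht]
    have hinv2 : ENNReal.ofReal (t ^ (-r)) = (b ^ r)⁻¹ := by
      rw [← ENNReal.ofReal_rpow_of_pos ht, ENNReal.rpow_neg]
    have h3 : μ {x | b < lr r (fun n => dmax μ c N (U₁ n) x)} ≤
        (1 + strongConst r * (D + 1) ^ (r - 1)) *
          (b⁻¹ * ∫⁻ x, (if b < F x then F x else 0) ∂μ) := by
      rw [mul_left_comm, mul_comm b⁻¹, ← div_eq_mul_inv,
        ENNReal.le_div_iff_mul_le (Or.inl hb0) (Or.inl hbt), mul_comm]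
      exact h1
    have h4 : μ {x | b < lr r (fun n => dmax μ c N (U₂ n) x)} ≤
        strongConst r * ((b ^ r)⁻¹ * ∫⁻ x, (if F x ≤ b then F x ^ r else 0) ∂μ) := by
      rw [mul_left_comm, mul_comm (b ^ r)⁻¹, ← div_eq_mul_inv,
        ENNReal.le_div_iff_mul_le (Or.inl hbr0) (Or.inl hbrt), mul_comm]
      refine le_trans ?_ h2
      refine le_trans ?_ (mul_meas_ge_le_lintegral (hAm.pow_const r) (b ^ r))
      gcongr 2
      intro x hx
      exact ENNReal.rpow_le_rpow (le_of_lt hx) hr0.le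
    rw [hinv1, hinv2]
    calc μ {x | b < A x / 2} ≤ _ := (measure_mono hsub).trans (measure_union_le _ _)
      _ ≤ _ := add_le_add h3 h4
      _ ≤ _ := by
        rw [mul_add]
        exact add_le_add (mul_le_mul' le_self_add le_rfl) (mul_le_mul' le_add_self le_rfl)

/-- Duality: write `A ^ p` as `A ^ r * A ^ (p - r)` and treat the second factor as a weight. The
weighted inequality moves the maximal operator onto it, and Hölder with exponents `p / r` and `p /
(p - r)` together with the scalar strong type bound returns a power of the left side. -/
theorem lintegral_lr_dmax_rpow_le_of_gt [SigmaFinite μ] (hc : IsDyadic μ c D) {p r : ℝ}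
    (hr : 1 < r) (hrp : r < p) {U : ℕ → X → ℝ≥0∞} (hU : ∀ n, Measurable (U n)) :
    ∫⁻ x, lr r (fun n => dmax μ c N (U n) x) ^ p ∂μ ≤
      (strongConst r * strongConst (p / (p - r)) ^ (1 / (p / (p - r)))) ^ (p / r) *
        ∫⁻ x, lr r (fun n => U n x) ^ p ∂μ := by
  have hr0 : 0 < r := by linarith
  have hp0 : 0 < p := by linarith
  have hpr : 0 < p - r := by linarith
  set A : X → ℝ≥0∞ := fun x => lr r (fun n => dmax μ c N (U n) x) with hAdef
  have hA : Measurable A := measurable_lr r fun n => hc.measurable_dmax (U n)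
  set F : X → ℝ≥0∞ := fun x => lr r (fun n => U n x) with hF
  have hFm : Measurable F := measurable_lr r hU
  set q := p / (p - r) with hq
  set s := p / r with hs
  have hs1 : 1 < s := by rw [hs, one_lt_div hr0]; exact hrp
  have hq1 : 1 < q := by rw [hq, one_lt_div hpr]; linarith
  have hs0 : 0 < s := by linarith
  have hq0 : 0 < q := by linarith
  have hsq : s.HolderConjugate q := by
    rw [Real.holderConjugate_iff]
    refine ⟨hs1, ?_⟩
    rw [hs, hq]
    field_simp
    ring
  have hpq : (p - r) * q = p := by rw [hq]; field_simp
  have hrs : r * s = p := by rw [hs]; field_simp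
  set S := spanningSets μ with hS
  -- Absorbing the left side requires it to be finite, so `A` is truncated in height and in space;
  -- `B m` increases to `A`.
  set B : ℕ → X → ℝ≥0∞ := fun m => (S m).indicator fun x => min (A x) m with hBdef
  have hB : ∀ m, Measurable (B m) := fun m =>
    (hA.min measurable_const).indicator (measurableSet_spanningSets μ m)
  have hBA : ∀ m x, B m x ≤ A x := fun m x =>
    (Set.indicator_le_self _ _ x).trans (min_le_left _ _)
  have hfin : ∀ m, ∫⁻ x, B m x ^ p ∂μ ≠ ∞ := by
    intro m
    have hle : ∀ x, B m x ^ p ≤ (S m).indicator (fun _ => (m : ℝ≥0∞) ^ p) x := by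
      intro x
      by_cases hx : x ∈ S m
      · simp only [hBdef, Set.indicator_of_mem hx]
        exact ENNReal.rpow_le_rpow (min_le_right _ _) hp0.le
      · simp [hBdef, hx, hp0]
    refine ne_top_of_le_ne_top ?_ (lintegral_mono hle)
    rw [lintegral_indicator_const (measurableSet_spanningSets μ m)]
    exact ENNReal.mul_ne_top (ENNReal.rpow_ne_top_of_nonneg hp0.le (ENNReal.natCast_ne_top m))
      (measure_spanningSets_lt_top μ m).ne
  have hbound : ∀ m, ∫⁻ x, B m x ^ p ∂μ ≤
      (strongConst r * strongConst q ^ (1 / q)) ^ s * ∫⁻ x, F x ^ p ∂μ := by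
    intro m
    set Y := ∫⁻ x, B m x ^ p ∂μ with hY
    set I := ∫⁻ x, F x ^ p ∂μ with hI
    by_cases hY0 : Y = 0
    · rw [hY0]; exact zero_le
    set φ : X → ℝ≥0∞ := fun x => B m x ^ (p - r) with hφ
    have hφm : Measurable φ := (hB m).pow_const _
    have h1 : Y ≤ strongConst r * (I ^ (1 / s) * (strongConst q * Y) ^ (1 / q)) := by
      calc Y ≤ ∫⁻ x, A x ^ r * φ x ∂μ := by
            refine lintegral_mono fun x => ?_
            calc B m x ^ p = B m x ^ r * B m x ^ (p - r) := by
                  rw [← ENNReal.rpow_add_of_nonneg _ _ hr0.le hpr.le]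
                  simp
              _ ≤ _ := by
                  gcongr
                  exact hBA m x
        _ ≤ strongConst r * ∫⁻ x, F x ^ r * dmax μ c N φ x ∂μ :=
            hc.lintegral_lr_dmax_rpow_mul_le hr hU hφm
        _ ≤ strongConst r * ((∫⁻ x, (F x ^ r) ^ s ∂μ) ^ (1 / s) *
              (∫⁻ x, dmax μ c N φ x ^ q ∂μ) ^ (1 / q)) := by
            gcongr
            exact ENNReal.lintegral_mul_le_Lp_mul_Lq μ hsq (hFm.pow_const r).aemeasurable
              (hc.measurable_dmax φ).aemeasurable
        _ ≤ _ := by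
            simp_rw [← ENNReal.rpow_mul, hrs]
            gcongr
            have h := hc.lintegral_dmax_rpow_mul_le (N := N) hq1 hφm (w := fun _ => 1)
              measurable_const
            simp_rw [mul_one] at h
            refine h.trans ?_
            gcongr
            refine lintegral_mono fun x => ?_
            calc φ x ^ q * dmax μ c N (fun _ => 1) x ≤ φ x ^ q * 1 := by
                  gcongr
                  exact dmax_le_const (fun _ => le_rfl) x
              _ = B m x ^ p := by rw [mul_one, hφ, ← ENNReal.rpow_mul, hpq]
    have h2 : Y ^ (1 / s) ≤ strongConst r * strongConst q ^ (1 / q) * I ^ (1 / s) := by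
      have h3 : Y ^ (1 / q) * Y ^ (1 / s) = Y := by
        rw [← ENNReal.rpow_add _ _ hY0 (hfin m), one_div, one_div, add_comm,
          hsq.inv_add_inv_eq_one, ENNReal.rpow_one]
      have hYt : Y ≠ ∞ := hfin m
      have h4 : Y ^ (1 / q) ≠ 0 := by simp [hY0, hYt]
      have h5 : Y ^ (1 / q) ≠ ∞ := ENNReal.rpow_ne_top_of_nonneg (by positivity) (hfin m)
      refine (ENNReal.mul_le_mul_iff_right h4 h5).1 ?_
      rw [h3]
      refine h1.trans (le_of_eq ?_)
      rw [ENNReal.mul_rpow_of_nonneg _ _ (by positivity)]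
      ring
    calc Y = (Y ^ (1 / s)) ^ s := by
          rw [← ENNReal.rpow_mul, one_div_mul_cancel hs0.ne', ENNReal.rpow_one]
      _ ≤ (strongConst r * strongConst q ^ (1 / q) * I ^ (1 / s)) ^ s :=
          ENNReal.rpow_le_rpow h2 hs0.le
      _ = _ := by
          rw [ENNReal.mul_rpow_of_nonneg _ _ hs0.le, ← ENNReal.rpow_mul I,
            one_div_mul_cancel hs0.ne', ENNReal.rpow_one]
  have hmono : Monotone B := by
    intro m m' hmm x
    refine Set.indicator_le_indicator_of_subset (monotone_spanningSets μ hmm)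
      (fun _ => zero_le) x |>.trans ?_
    refine Set.indicator_le_indicator ?_
    gcongr
  have hsup : ∀ x, A x ^ p = ⨆ m, B m x ^ p := by
    intro x
    have h : A x = ⨆ m, B m x := by
      refine le_antisymm (le_of_forall_lt fun a ha => ?_) (iSup_le fun m => hBA m x)
      obtain ⟨m, hm⟩ := ENNReal.exists_nat_gt (ne_top_of_lt ha)
      have hx : x ∈ ⋃ m, S m := by rw [hS, iUnion_spanningSets]; trivial
      obtain ⟨m₀, hm₀⟩ := Set.mem_iUnion.1 hx
      refine lt_of_lt_of_le ?_ (le_iSup (fun m => B m x) (max m m₀))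
      have hx' : x ∈ S (max m m₀) := monotone_spanningSets μ (le_max_right m m₀) hm₀
      simp only [hBdef, Set.indicator_of_mem hx']
      refine lt_min ha (hm.trans_le ?_)
      exact_mod_cast le_max_left m m₀
    rw [h]
    exact (ENNReal.orderIsoRpow p hp0).map_iSup _
  refine (lintegral_congr hsup).trans_le ?_
  rw [lintegral_iSup (fun m => (hB m).pow_const p)]
  · exact iSup_le hbound
  · intro m m' hmm x
    exact ENNReal.rpow_le_rpow (hmono hmm x) hp0.le

end IsDyadic

/-! ### All dyadic levels, and finite sums of dyadic maximal operators. -/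

/-- The maximal function over the cells of all levels of a two-sided sequence of partitions. -/
noncomputable def dmaxZ {X ι : Type*} [MeasurableSpace X] (μ : Measure X) (c : ℤ → X → ι)
    (u : X → ℝ≥0∞) (x : X) : ℝ≥0∞ :=
  ⨆ k : ℤ, condE μ (c k) u x

section twoSided

variable {X ι : Type*} [MeasurableSpace X] {μ : Measure X} {D : ℝ≥0}

/-- The window `J` consists of the levels from `-J` to `J`, reindexed to start at `0`; level `k` of
window `J` is level `k + (J' - J)` of window `J'`. -/
theorem monotone_dmax_window (c : ℤ → X → ι) (u : X → ℝ≥0∞) (x : X) :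
    Monotone fun J : ℕ => dmax μ (fun k : ℕ => c (k - J)) (2 * J) u x := by
  intro J J' h
  refine iSup₂_le fun k hk => ?_
  have hk' : k + (J' - J) ≤ 2 * J' := by omega
  refine le_trans (le_of_eq ?_) (condE_le_dmax hk' u x)
  have : ((k + (J' - J) : ℕ) : ℤ) - J' = k - J := by omega
  rw [this]

theorem dmaxZ_eq_iSup (c : ℤ → X → ι) (u : X → ℝ≥0∞) (x : X) :
    dmaxZ μ c u x = ⨆ J : ℕ, dmax μ (fun k : ℕ => c (k - J)) (2 * J) u x := by
  refine le_antisymm (iSup_le fun k => ?_) (iSup_le fun J => iSup₂_le fun k _ => ?_)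
  · refine le_iSup_of_le k.natAbs ?_
    have hk : (k + k.natAbs).toNat ≤ 2 * k.natAbs := by omega
    refine le_trans (le_of_eq ?_) (condE_le_dmax hk u x)
    have : (((k + k.natAbs).toNat : ℕ) : ℤ) - k.natAbs = k := by omega
    rw [this]
  · exact le_iSup (fun k : ℤ => condE μ (c k) u x) _

theorem lr_dmaxZ_eq_iSup {r : ℝ} (hr : 0 < r) (c : ℤ → X → ι) (U : ℕ → X → ℝ≥0∞) (x : X) :
    lr r (fun n => dmaxZ μ c (U n) x) =
      ⨆ J : ℕ, lr r fun n => dmax μ (fun k : ℕ => c (k - J)) (2 * J) (U n) x := by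
  simp_rw [dmaxZ_eq_iSup]
  exact lr_iSup hr (fun J n => dmax μ (fun k : ℕ => c (k - J)) (2 * J) (U n) x)
    fun J J' h n => monotone_dmax_window c (U n) x h

variable [Countable ι]

/-- The constant is chosen before the partitions and the number of levels; this uniformity permits
the passage to all levels. -/
theorem exists_lintegral_lr_dmax_rpow_le [SigmaFinite μ] (D : ℝ≥0) {r p : ℝ} (hr : 1 < r)
    (hp : 1 < p) :
    ∃ K : ℝ≥0, ∀ (c : ℕ → X → ι) (N : ℕ), IsDyadic μ c D →
      ∀ U : ℕ → X → ℝ≥0∞, (∀ n, Measurable (U n)) →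
        ∫⁻ x, lr r (fun n => dmax μ c N (U n) x) ^ p ∂μ ≤
          K * ∫⁻ x, lr r (fun n => U n x) ^ p ∂μ := by
  have hK : ∀ s : ℝ, 1 < s → strongConst s ≠ ∞ := fun s hs =>
    strongConst_ne_top (by linarith)
  have key : ∃ K : ℝ≥0∞, K ≠ ∞ ∧ ∀ (c : ℕ → X → ι) (N : ℕ), IsDyadic μ c D →
      ∀ U : ℕ → X → ℝ≥0∞, (∀ n, Measurable (U n)) →
        ∫⁻ x, lr r (fun n => dmax μ c N (U n) x) ^ p ∂μ ≤
          K * ∫⁻ x, lr r (fun n => U n x) ^ p ∂μ := by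
    rcases lt_trichotomy p r with h | h | h
    · refine ⟨_, ?_, fun c N hc U hU => hc.lintegral_lr_dmax_rpow_le_of_lt hp h hU⟩
      have h1 : (2 : ℝ≥0∞) ^ p ≠ ∞ :=
        ENNReal.rpow_ne_top_of_nonneg (by linarith) ENNReal.ofNat_ne_top
      have h2 : ((D : ℝ≥0∞) + 1) ^ (r - 1) ≠ ∞ :=
        ENNReal.rpow_ne_top_of_nonneg (by linarith) (by finiteness)
      have h3 := hK r hr
      finiteness
    · subst h
      exact ⟨_, hK p hp, fun c N hc U hU => hc.lintegral_lr_dmax_rpow_self_le hr hU⟩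
    · refine ⟨_, ?_, fun c N hc U hU => hc.lintegral_lr_dmax_rpow_le_of_gt hr h hU⟩
      have hq : 1 < p / (p - r) := by
        rw [one_lt_div (by linarith)]
        linarith
      refine ENNReal.rpow_ne_top_of_nonneg (by positivity) (ENNReal.mul_ne_top (hK r hr) ?_)
      exact ENNReal.rpow_ne_top_of_nonneg (by positivity) (hK _ hq)
  obtain ⟨K, hKt, h⟩ := key
  lift K to ℝ≥0 using hKt
  exact ⟨K, h⟩

theorem exists_lintegral_lr_dmaxZ_rpow_le [SigmaFinite μ] (D : ℝ≥0) {r p : ℝ} (hr : 1 < r)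
    (hp : 1 < p) :
    ∃ K : ℝ≥0, ∀ c : ℤ → X → ι, (∀ J : ℕ, IsDyadic μ (fun k : ℕ => c (k - J)) D) →
      ∀ U : ℕ → X → ℝ≥0∞, (∀ n, Measurable (U n)) →
        ∫⁻ x, lr r (fun n => dmaxZ μ c (U n) x) ^ p ∂μ ≤
          K * ∫⁻ x, lr r (fun n => U n x) ^ p ∂μ := by
  obtain ⟨K, hK⟩ := exists_lintegral_lr_dmax_rpow_le (μ := μ) (ι := ι) D hr hp
  refine ⟨K, fun c hc U hU => ?_⟩
  have hp0 : 0 < p := by linarith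
  have hr0 : 0 < r := by linarith
  have h : ∀ x, lr r (fun n => dmaxZ μ c (U n) x) ^ p =
      ⨆ J : ℕ, lr r (fun n => dmax μ (fun k : ℕ => c (k - J)) (2 * J) (U n) x) ^ p := by
    intro x
    rw [lr_dmaxZ_eq_iSup hr0]
    exact (ENNReal.orderIsoRpow p hp0).map_iSup _
  refine (lintegral_congr h).trans_le ?_
  rw [lintegral_iSup]
  · exact iSup_le fun J => hK _ _ (hc J) U hU
  · exact fun J => (measurable_lr r fun n => (hc J).measurable_dmax (U n)).pow_const p
  · intro J J' hJ x
    exact ENNReal.rpow_le_rpow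
      (lr_mono hr0 fun n => monotone_dmax_window c (U n) x hJ) hp0.le

theorem exists_mul_measure_lr_dmaxZ_le [SFinite μ] (D : ℝ≥0) {r : ℝ} (hr : 1 < r) :
    ∃ K : ℝ≥0, ∀ c : ℤ → X → ι, (∀ J : ℕ, IsDyadic μ (fun k : ℕ => c (k - J)) D) →
      ∀ U : ℕ → X → ℝ≥0∞, (∀ n, Measurable (U n)) → ∀ a : ℝ≥0∞, a ≠ 0 → a ≠ ∞ →
        a * μ {x | a < lr r (fun n => dmaxZ μ c (U n) x)} ≤
          K * ∫⁻ x, lr r (fun n => U n x) ∂μ := by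
  have hr0 : 0 < r := by linarith
  have hfin : 1 + strongConst r * ((D : ℝ≥0∞) + 1) ^ (r - 1) ≠ ∞ := by
    have h2 : ((D : ℝ≥0∞) + 1) ^ (r - 1) ≠ ∞ :=
      ENNReal.rpow_ne_top_of_nonneg (by linarith) (by finiteness)
    have h3 := strongConst_ne_top hr0.le
    finiteness
  refine ⟨(1 + strongConst r * ((D : ℝ≥0∞) + 1) ^ (r - 1)).toNNReal,
    fun c hc U hU a ha0 ha => ?_⟩
  rw [ENNReal.coe_toNNReal hfin]
  have hset : {x | a < lr r (fun n => dmaxZ μ c (U n) x)} =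
      ⋃ J : ℕ, {x | a < lr r fun n => dmax μ (fun k : ℕ => c (k - J)) (2 * J) (U n) x} := by
    ext x
    simp [lr_dmaxZ_eq_iSup hr0, lt_iSup_iff]
  rw [hset, Monotone.measure_iUnion, ENNReal.mul_iSup]
  · exact iSup_le fun J => (hc J).mul_measure_lr_dmax_le hr hU ha0 ha
  · intro J J' hJ x hx
    exact lt_of_lt_of_le (b := lr r fun n => dmax μ (fun k : ℕ => c (k - J)) (2 * J) (U n) x) hx
      (lr_mono hr0 fun n => monotone_dmax_window c (U n) x hJ)

/-- The vector-valued strong type inequality for operators dominated by finitely many dyadic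
maximal functions. -/
theorem exists_lintegral_lr_rpow_le_of_le_sum [SigmaFinite μ] {S : Type*} [Fintype S] (D E : ℝ≥0)
    {r p : ℝ} (hr : 1 < r) (hp : 1 < p) (c : S → ℤ → X → ι)
    (hc : ∀ s, ∀ J : ℕ, IsDyadic μ (fun k : ℕ => c s (k - J)) D) :
    ∃ K : ℝ≥0, ∀ U V : ℕ → X → ℝ≥0∞, (∀ n, Measurable (U n)) →
      (∀ n x, V n x ≤ E * ∑ s, dmaxZ μ (c s) (U n) x) →
        ∫⁻ x, lr r (fun n => V n x) ^ p ∂μ ≤ K * ∫⁻ x, lr r (fun n => U n x) ^ p ∂μ := by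
  obtain ⟨K, hK⟩ := exists_lintegral_lr_dmaxZ_rpow_le (μ := μ) (ι := ι) D hr hp
  have hp0 : 0 < p := by linarith
  have hr0 : 0 < r := by linarith
  have hT : (E : ℝ≥0∞) ^ p * (Fintype.card S : ℝ≥0∞) ^ (p - 1) * (Fintype.card S * K) ≠ ∞ := by
    have h1 : (E : ℝ≥0∞) ^ p ≠ ∞ := ENNReal.rpow_ne_top_of_nonneg hp0.le ENNReal.coe_ne_top
    have h2 : (Fintype.card S : ℝ≥0∞) ^ (p - 1) ≠ ∞ :=
      ENNReal.rpow_ne_top_of_nonneg (by linarith) (ENNReal.natCast_ne_top _)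
    finiteness
  refine ⟨((E : ℝ≥0∞) ^ p * (Fintype.card S : ℝ≥0∞) ^ (p - 1) *
    (Fintype.card S * K)).toNNReal, fun U V hU hV => ?_⟩
  rw [ENNReal.coe_toNNReal hT]
  have hmeas : ∀ s, Measurable fun x => lr r fun n => dmaxZ μ (c s) (U n) x := fun s =>
    measurable_lr r fun n => Measurable.iSup fun k => by
      have := (hc s k.natAbs).measurable_condE (k + k.natAbs).toNat (U n)
      have hk : (((k + k.natAbs).toNat : ℕ) : ℤ) - k.natAbs = k := by omega
      simpa only [hk] using this
  have hpt : ∀ x, lr r (fun n => V n x) ^ p ≤ (E : ℝ≥0∞) ^ p *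
      (Fintype.card S : ℝ≥0∞) ^ (p - 1) * ∑ s, lr r (fun n => dmaxZ μ (c s) (U n) x) ^ p := by
    intro x
    calc lr r (fun n => V n x) ^ p
        ≤ (E * ∑ s, lr r (fun n => dmaxZ μ (c s) (U n) x)) ^ p := by
          refine ENNReal.rpow_le_rpow ((lr_mono hr0 fun n => hV n x).trans ?_) hp0.le
          rw [lr_const_mul hr0]
          gcongr
          exact lr_sum_le hr.le _ _
      _ ≤ _ := by
          rw [ENNReal.mul_rpow_of_nonneg _ _ hp0.le, mul_assoc]
          gcongr
          exact ENNReal.rpow_sum_le_const_mul_sum_rpow _ _ hp.le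
  refine (lintegral_mono hpt).trans ?_
  rw [lintegral_const_mul _ (Finset.measurable_sum _ fun s _ => (hmeas s).pow_const p),
    lintegral_finsetSum _ fun s _ => (hmeas s).pow_const p,
    mul_assoc ((E : ℝ≥0∞) ^ p * (Fintype.card S : ℝ≥0∞) ^ (p - 1))]
  refine mul_le_mul_right ?_ _
  calc _ ≤ ∑ _s : S, K * ∫⁻ x, lr r (fun n => U n x) ^ p ∂μ :=
        Finset.sum_le_sum fun s _ => hK (c s) (hc s) U hU
    _ = _ := by rw [Finset.sum_const, Finset.card_univ, nsmul_eq_mul, mul_assoc]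

/-- The vector-valued weak type inequality for operators dominated by finitely many dyadic
maximal functions. -/
theorem exists_mul_measure_lr_le_of_le_sum [SFinite μ] {S : Type*} [Fintype S] (D E : ℝ≥0)
    {r : ℝ} (hr : 1 < r) (c : S → ℤ → X → ι)
    (hc : ∀ s, ∀ J : ℕ, IsDyadic μ (fun k : ℕ => c s (k - J)) D) :
    ∃ K : ℝ≥0, ∀ U V : ℕ → X → ℝ≥0∞, (∀ n, Measurable (U n)) →
      (∀ n x, V n x ≤ E * ∑ s, dmaxZ μ (c s) (U n) x) → ∀ a : ℝ≥0∞, a ≠ 0 → a ≠ ∞ →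
        a * μ {x | a < lr r (fun n => V n x)} ≤ K * ∫⁻ x, lr r (fun n => U n x) ∂μ := by
  obtain ⟨K, hK⟩ := exists_mul_measure_lr_dmaxZ_le (μ := μ) (ι := ι) D hr
  have hr0 : 0 < r := by linarith
  -- By pigeonhole one of the summands exceeds `a / T` wherever the sum exceeds `a`; the `+ 1` keeps
  -- the divisor nonzero.
  set T : ℝ≥0 := E * Fintype.card S + 1 with hT
  have hT0 : (T : ℝ≥0∞) ≠ 0 := by simp [hT]
  refine ⟨T * (Fintype.card S * K), fun U V hU hV a ha0 ha => ?_⟩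
  have hb0 : a / T ≠ 0 := (ENNReal.div_pos ha0 ENNReal.coe_ne_top).ne'
  have hbt : a / T ≠ ∞ := ENNReal.div_ne_top ha hT0
  have hTa : T * (a / T) = a := ENNReal.mul_div_cancel hT0 ENNReal.coe_ne_top
  have hsub : {x | a < lr r (fun n => V n x)} ⊆
      ⋃ s, {x | a / T < lr r (fun n => dmaxZ μ (c s) (U n) x)} := by
    intro x hx
    by_contra hcon
    simp only [Set.mem_iUnion, Set.mem_ofPred_eq, not_exists, not_lt] at hcon
    have hx' : a < lr r (fun n => V n x) := hx
    refine absurd hx' (not_lt.2 ?_)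
    calc lr r (fun n => V n x) ≤ lr r (fun n => E * ∑ s, dmaxZ μ (c s) (U n) x) :=
          lr_mono hr0 fun n => hV n x
      _ ≤ E * ∑ s, lr r (fun n => dmaxZ μ (c s) (U n) x) := by
          rw [lr_const_mul hr0]
          gcongr
          exact lr_sum_le hr.le _ _
      _ ≤ E * ∑ _s : S, a / T := by
          gcongr with s
          exact hcon s
      _ = (E * Fintype.card S) * (a / T) := by
          rw [Finset.sum_const, Finset.card_univ, nsmul_eq_mul, mul_assoc]
      _ ≤ T * (a / T) := by
          gcongr
          rw [hT]
          push_cast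
          exact le_self_add
      _ = a := hTa
  calc a * μ {x | a < lr r (fun n => V n x)}
      ≤ (T * (a / T)) * ∑ s, μ {x | a / T < lr r (fun n => dmaxZ μ (c s) (U n) x)} := by
        rw [hTa]
        gcongr
        exact (measure_mono hsub).trans (measure_iUnion_fintype_le _ _)
    _ = T * ∑ s, a / T * μ {x | a / T < lr r (fun n => dmaxZ μ (c s) (U n) x)} := by
        rw [mul_assoc, Finset.mul_sum]
    _ ≤ T * ∑ _s : S, K * ∫⁻ x, lr r (fun n => U n x) ∂μ := by
        exact mul_le_mul_right (Finset.sum_le_sum fun s _ => hK (c s) (hc s) U hU _ hb0 hbt) _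
    _ = _ := by
        rw [Finset.sum_const, Finset.card_univ, nsmul_eq_mul]
        push_cast
        ring

end twoSided

/-! ### The one-third trick: two adjacent dyadic grids on the half line. -/

/-- The relative offset of the grid of side `2 ^ k`: zero, or one third with alternating sign. -/
noncomputable def gridOffset (s : Bool) (k : ℤ) : ℝ :=
  if s then (if Even k then 1 / 3 else -(1 / 3)) else 0

/-- The index of the interval of the grid of side `2 ^ k` that contains `|t|`. -/
noncomputable def gridIndex (s : Bool) (k : ℤ) (t : ℝ) : ℤ :=
  ⌊|t| / 2 ^ k - gridOffset s k⌋

/-- The index of the cube of the grid of side `2 ^ k` that contains `(|x_1|, …, |x_d|)`. -/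
noncomputable def grid {d : ℕ} (σ : Fin d → Bool) (k : ℤ) (x : Fin d → ℝ) : Fin d → ℤ :=
  fun j => gridIndex (σ j) k (x j)

theorem floor_half (w : ℝ) : ⌊w / 2⌋ = ⌊w⌋ / 2 := by
  have h1 := Int.floor_le w
  have h2 := Int.lt_floor_add_one w
  have h3 : (⌊w⌋ / 2) * 2 ≤ ⌊w⌋ := by omega
  have h4 : ⌊w⌋ + 1 ≤ (⌊w⌋ / 2) * 2 + 2 := by omega
  have h3' : ((⌊w⌋ / 2 : ℤ) : ℝ) * 2 ≤ ⌊w⌋ := by exact_mod_cast h3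
  have h4' : (⌊w⌋ : ℝ) + 1 ≤ ((⌊w⌋ / 2 : ℤ) : ℝ) * 2 + 2 := by exact_mod_cast h4
  rw [Int.floor_eq_iff]
  constructor <;> linarith

/-- Nestedness amounts to `θ_k - 2 θ_{k+1}` being an integer for the offsets `θ`. This is why the
sign alternates: `1/3 + 2/3 = 1` and `-1/3 - 2/3 = -1`. -/
theorem exists_gridIndex_succ (s : Bool) (k : ℤ) :
    ∃ e : ℤ, ∀ t, gridIndex s (k + 1) t = (gridIndex s k t + e) / 2 := by
  have he : ∃ e : ℤ, gridOffset s k - 2 * gridOffset s (k + 1) = e := by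
    unfold gridOffset
    cases s
    · exact ⟨0, by simp⟩
    · by_cases hk : Even k
      · have hk' : ¬ Even (k + 1) := by rw [Int.not_even_iff_odd]; exact hk.add_one
        exact ⟨1, by simp only [hk, hk', if_true, if_false]; norm_num⟩
      · have hk' : Even (k + 1) := (Int.not_even_iff_odd.1 hk).add_one
        exact ⟨-1, by simp only [hk, hk', if_true, if_false]; norm_num⟩
  obtain ⟨e, he⟩ := he
  refine ⟨e, fun t => ?_⟩
  unfold gridIndex
  rw [← Int.floor_add_intCast, ← floor_half, ← he, zpow_add_one₀ two_ne_zero]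
  congr 1
  field_simp
  ring

theorem abs_gridOffset_le (s : Bool) (k : ℤ) : |gridOffset s k| ≤ 1 / 3 := by
  unfold gridOffset
  split_ifs <;> norm_num [abs_le]

theorem abs_sub_lt_of_gridIndex_eq {s : Bool} {k : ℤ} {t u : ℝ}
    (h : gridIndex s k t = gridIndex s k u) : |(|t| - |u|)| < 2 ^ k := by
  have h2 : (0 : ℝ) < 2 ^ k := by positivity
  have h1 := Int.abs_sub_lt_one_of_floor_eq_floor h
  rw [sub_sub_sub_cancel_right, ← sub_div, abs_div, abs_of_pos h2, div_lt_one h2] at h1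
  exact h1

/-- The part of a grid interval in the half line contains an interval of comparable length. -/
theorem exists_Ico_gridIndex (s : Bool) (k : ℤ) (t : ℝ) : ∃ a b : ℝ, 0 ≤ a ∧ a < b ∧ |t| < b ∧
    (2 : ℝ) ^ k ≤ 3 * (b - a) ∧ ∀ u ∈ Set.Ico a b, gridIndex s k u = gridIndex s k t := by
  have h2 : (0 : ℝ) < 2 ^ k := by positivity
  set m := gridIndex s k t with hm
  set θ := gridOffset s k with hθ
  have hm' : m = ⌊|t| / 2 ^ k - θ⌋ := rfl
  have hθ3 := abs_le.1 (abs_gridOffset_le s k)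
  rw [← hθ] at hθ3
  have hlt : |t| / 2 ^ k < m + 1 + θ := by
    have := Int.lt_floor_add_one (|t| / 2 ^ k - θ)
    rw [← hm'] at this
    linarith
  have htb : |t| < 2 ^ k * (m + 1 + θ) := by
    rwa [div_lt_iff₀' h2] at hlt
  have hm0 : (0 : ℝ) ≤ m + 1 := by
    have : (-1 : ℝ) < ((m + 1 : ℤ) : ℝ) := by
      have : 0 ≤ |t| / 2 ^ k := by positivity
      push_cast
      linarith
    have : (-1 : ℤ) < m + 1 := by exact_mod_cast this
    have : (0 : ℤ) ≤ m + 1 := by omega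
    exact_mod_cast this
  -- The right endpoint, in units of `2 ^ k`, is positive. If `m + 1 ≥ 1` it is at least `2 / 3`; if
  -- `m + 1 = 0` then the offset itself is positive, hence `1 / 3`. So cutting the interval at `0`
  -- leaves at least a third of its length.
  have hpos : 1 / 3 ≤ m + 1 + θ := by
    have h0 : 0 < m + 1 + θ := lt_of_le_of_lt (by positivity) hlt
    rcases hm0.lt_or_eq with h | h
    · have : (0 : ℤ) < m + 1 := by exact_mod_cast h
      have : (1 : ℤ) ≤ m + 1 := by omega
      have : (1 : ℝ) ≤ m + 1 := by exact_mod_cast this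
      linarith
    · rw [← h, zero_add] at h0 ⊢
      rw [hθ] at h0 ⊢
      unfold gridOffset at h0 ⊢
      split_ifs at h0 ⊢ <;> first | exact le_rfl | norm_num at h0
  have hlen : (2 : ℝ) ^ k ≤ 3 * (2 ^ k * (m + 1 + θ) - max 0 (2 ^ k * (m + θ))) := by
    rcases max_cases 0 ((2 : ℝ) ^ k * (m + θ)) with ⟨h, _⟩ | ⟨h, _⟩ <;> rw [h] <;> nlinarith
  refine ⟨max 0 (2 ^ k * (m + θ)), 2 ^ k * (m + 1 + θ), le_max_left _ _, by linarith, htb, hlen,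
    fun u hu => ?_⟩
  have hu0 : 0 ≤ u := (le_max_left _ _).trans hu.1
  have h3 : m + θ ≤ u / 2 ^ k := by
    rw [le_div_iff₀' h2]
    exact (le_max_right _ _).trans hu.1
  have h4 : u / 2 ^ k < m + 1 + θ := by
    rw [div_lt_iff₀' h2]
    exact hu.2
  unfold gridIndex
  rw [Int.floor_eq_iff, abs_of_nonneg hu0, ← hθ]
  constructor <;> linarith

/-- A set of diameter less than a third of the side lies in an interval of one of the two grids. -/
theorem exists_gridIndex_eq {k : ℤ} {T : Set ℝ} (hT : ∀ t ∈ T, ∀ u ∈ T, 3 * (|t| - |u|) < 2 ^ k) :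
    ∃ s, ∀ t ∈ T, ∀ u ∈ T, gridIndex s k t = gridIndex s k u := by
  have h2 : (0 : ℝ) < 2 ^ k := by positivity
  by_cases h : ∀ t ∈ T, ∀ u ∈ T, gridIndex false k t = gridIndex false k u
  · exact ⟨false, h⟩
  have h' : ∃ t ∈ T, ∃ u ∈ T, gridIndex false k t < gridIndex false k u := by
    push Not at h
    obtain ⟨t, ht, u, hu, hne⟩ := h
    rcases lt_or_gt_of_ne hne with h | h
    · exact ⟨t, ht, u, hu, h⟩
    · exact ⟨u, hu, t, ht, h⟩
  obtain ⟨t, ht, u, hu, hlt⟩ := h'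
  have hT' : ∀ t ∈ T, ∀ u ∈ T, |t| / 2 ^ k < |u| / 2 ^ k + 1 / 3 := by
    intro t ht u hu
    have := hT t ht u hu
    rw [← sub_lt_iff_lt_add', ← sub_div, div_lt_iff₀ h2]
    linarith
  -- If the unshifted grid separates two points of `T`, then `m` lies between them in units of `2 ^
  -- k`, so all of `T` is within `1 / 3` of the integer `m`. The shifted interval is `[m - 2/3, m +
  -- 1/3)` or `[m - 1/3, m + 2/3)`, and either one contains `T`.
  set m := gridIndex false k u with hm
  have hmu : (m : ℝ) ≤ |u| / 2 ^ k := by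
    have := Int.floor_le (|u| / 2 ^ k - gridOffset false k)
    simpa [hm, gridIndex, gridOffset] using this
  have hmt : |t| / 2 ^ k < m := by
    have h3 : ((gridIndex false k t + 1 : ℤ) : ℝ) ≤ m := by exact_mod_cast hlt
    have h4 : |t| / 2 ^ k < ((gridIndex false k t + 1 : ℤ) : ℝ) := by
      simp [gridIndex, gridOffset]
    linarith
  have hw : ∀ w ∈ T, (m : ℝ) - 1 / 3 < |w| / 2 ^ k ∧ |w| / 2 ^ k < m + 1 / 3 := fun w hw' =>
    ⟨by linarith [hT' u hu w hw'], by linarith [hT' w hw' t ht]⟩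
  refine ⟨true, ?_⟩
  have : ∀ w ∈ T, gridIndex true k w = if Even k then m - 1 else m := by
    intro w hw'
    obtain ⟨h1, h3⟩ := hw w hw'
    unfold gridIndex gridOffset
    rw [if_pos rfl]
    split_ifs
    · rw [Int.floor_eq_iff]
      push_cast
      constructor <;> linarith
    · rw [Int.floor_eq_iff]
      constructor <;> linarith
  intro v hv w hw
  rw [this v hv, this w hw]

theorem measurable_gridIndex (s : Bool) (k : ℤ) : Measurable (gridIndex s k) := by
  unfold gridIndex
  exact Int.measurable_floor.comp (by fun_prop)

theorem measurable_grid {d : ℕ} (σ : Fin d → Bool) (k : ℤ) : Measurable (grid σ k) :=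
  measurable_pi_lambda _ fun j => (measurable_gridIndex (σ j) k).comp (measurable_pi_apply j)

/-! ### Measures of boxes, doubling, and domination by dyadic operators. -/

section measure

variable {d : ℕ} {κ : Fin d → ℝ}

theorem measurable_absCoord : Measurable (absCoord : (Fin d → ℝ) → Fin d → ℝ) := by
  unfold absCoord
  fun_prop

theorem measurableSet_rect (x : Fin d → ℝ) (r : ℝ) : MeasurableSet (rect x r) :=
  MeasurableSet.univ_pi fun _ => measurableSet_Ico

instance (κ : Fin d → ℝ) : SigmaFinite (mu κ) :=
  SigmaFinite.withDensity_ofReal _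

theorem volume_abs_mem_Ico_le (A B : ℝ) :
    volume {t : ℝ | |t| ∈ Set.Ico A B} ≤ ENNReal.ofReal (2 * (B - A)) := by
  have hsub : {t : ℝ | |t| ∈ Set.Ico A B} ⊆ Set.Ico A B ∪ Set.Ioc (-B) (-A) := by
    intro t ht
    rcases abs_cases t with ⟨h, _⟩ | ⟨h, _⟩
    · left
      simpa [h] using ht
    · right
      have ht' : |t| ∈ Set.Ico A B := ht
      rw [h] at ht'
      exact ⟨by linarith [ht'.2], by linarith [ht'.1]⟩
  calc volume {t : ℝ | |t| ∈ Set.Ico A B}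
      ≤ volume (Set.Ico A B) + volume (Set.Ioc (-B) (-A)) :=
        (measure_mono hsub).trans (measure_union_le _ _)
    _ = ENNReal.ofReal (2 * (B - A)) := by
        rw [Real.volume_Ico, Real.volume_Ioc, ENNReal.ofReal_mul zero_le_two, ENNReal.ofReal_ofNat,
          two_mul]
        congr 2
        ring

/-- The weight is bounded by its value at the outer corner; each coordinate ranges over two
reflected intervals of length at most `2 * ρ`. -/
theorem mu_absCoord_mem_rect_le (hκ : ∀ j, 0 ≤ κ j) (x : Fin d → ℝ) {ρ : ℝ} (hρ : 0 < ρ) :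
    mu κ {y | absCoord y ∈ rect x ρ} ≤
      ENNReal.ofReal (∏ j, 4 * ρ * ((|x j| + ρ) ^ κ j) ^ 2) := by
  have hS : MeasurableSet {y | absCoord y ∈ rect x ρ} := measurable_absCoord (measurableSet_rect x ρ)
  have hpi : {y | absCoord y ∈ rect x ρ} =
      Set.univ.pi fun j => {t : ℝ | |t| ∈ Set.Ico (max 0 (|x j| - ρ)) (|x j| + ρ)} := by
    ext y
    simp [rect, interval, absCoord]
  have hvol : volume {y | absCoord y ∈ rect x ρ} ≤ ENNReal.ofReal (∏ _j : Fin d, 4 * ρ) := by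
    rw [hpi, volume_pi_pi, ENNReal.ofReal_prod_of_nonneg fun _ _ => by positivity]
    refine Finset.prod_le_prod' fun j _ => (volume_abs_mem_Ico_le _ _).trans ?_
    refine ENNReal.ofReal_le_ofReal ?_
    linarith [le_max_right 0 (|x j| - ρ)]
  calc mu κ {y | absCoord y ∈ rect x ρ}
      = ∫⁻ y in {y | absCoord y ∈ rect x ρ}, ENNReal.ofReal (weight κ y ^ 2) :=
        withDensity_apply _ hS
    _ ≤ ∫⁻ _ in {y | absCoord y ∈ rect x ρ},
          ENNReal.ofReal ((∏ j, (|x j| + ρ) ^ κ j) ^ 2) := by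
        refine setLIntegral_mono' hS fun y hy => ENNReal.ofReal_le_ofReal ?_
        unfold weight
        gcongr with j
        · exact hκ j
        · exact (hy j (Set.mem_univ j)).2.le
    _ = ENNReal.ofReal ((∏ j, (|x j| + ρ) ^ κ j) ^ 2) * volume {y | absCoord y ∈ rect x ρ} :=
        setLIntegral_const _ _
    _ ≤ ENNReal.ofReal ((∏ j, (|x j| + ρ) ^ κ j) ^ 2) * ENNReal.ofReal (∏ _j : Fin d, 4 * ρ) := by
        gcongr
    _ = _ := by
        rw [← ENNReal.ofReal_mul (by positivity), ← Finset.prod_pow, ← Finset.prod_mul_distrib]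
        simp_rw [mul_comm]

/-- Only the upper half of the box in each coordinate is kept, where `y j ≥ b j / 2` bounds the
weight from below. -/
theorem le_mu_box (hκ : ∀ j, 0 ≤ κ j) {a b : Fin d → ℝ} (ha : ∀ j, 0 ≤ a j)
    (hab : ∀ j, a j < b j) :
    ENNReal.ofReal (∏ j, (b j - a j) / 2 * ((b j / 2) ^ κ j) ^ 2) ≤
      mu κ (Set.univ.pi fun j => Set.Ico (a j) (b j)) := by
  have hb : ∀ j, 0 < b j := fun j => (ha j).trans_lt (hab j)
  have hBm : MeasurableSet (Set.univ.pi fun j => Set.Ico ((a j + b j) / 2) (b j)) :=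
    MeasurableSet.univ_pi fun _ => measurableSet_Ico
  calc ENNReal.ofReal (∏ j, (b j - a j) / 2 * ((b j / 2) ^ κ j) ^ 2)
      = ENNReal.ofReal ((∏ j, (b j / 2) ^ κ j) ^ 2) *
          volume (Set.univ.pi fun j => Set.Ico ((a j + b j) / 2) (b j)) := by
        rw [Real.volume_pi_Ico, ← ENNReal.ofReal_prod_of_nonneg fun j _ => by linarith [hab j],
          ← ENNReal.ofReal_mul (by positivity), Finset.prod_mul_distrib, Finset.prod_pow, mul_comm]
        congr 3 with j
        ring
    _ = ∫⁻ _ in Set.univ.pi fun j => Set.Ico ((a j + b j) / 2) (b j),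
          ENNReal.ofReal ((∏ j, (b j / 2) ^ κ j) ^ 2) := (setLIntegral_const _ _).symm
    _ ≤ ∫⁻ y in Set.univ.pi fun j => Set.Ico ((a j + b j) / 2) (b j),
          ENNReal.ofReal (weight κ y ^ 2) := by
        refine setLIntegral_mono' hBm fun y hy => ENNReal.ofReal_le_ofReal ?_
        unfold weight
        have hpos : ∀ j, 0 ≤ b j / 2 := fun j => (half_pos (hb j)).le
        have hle : ∀ j, b j / 2 ≤ |y j| := fun j => by
          refine le_trans ?_ ((hy j (Set.mem_univ j)).1.trans (le_abs_self _))
          linarith [ha j]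
        refine pow_le_pow_left₀ (Finset.prod_nonneg fun j _ => Real.rpow_nonneg (hpos j) _) ?_ 2
        exact Finset.prod_le_prod (fun j _ => Real.rpow_nonneg (hpos j) _) fun j _ =>
          Real.rpow_le_rpow (hpos j) (hle j) (hκ j)
    _ = mu κ (Set.univ.pi fun j => Set.Ico ((a j + b j) / 2) (b j)) :=
        (withDensity_apply _ hBm).symm
    _ ≤ _ := by
        refine measure_mono (Set.pi_mono fun j _ => Set.Ico_subset_Ico_left ?_)
        linarith [hab j]

/-- The constant in the comparison of the measures of boxes of comparable size and position. -/
noncomputable def boxConst (κ : Fin d → ℝ) : ℝ≥0 :=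
  Real.toNNReal (∏ j, 96 * ((48 : ℝ) ^ κ j) ^ 2)

/-- Compares a symmetrized rectangle with a box in the positive orthant. The thresholds `12` and
`24` are generous enough for both uses: doubling of the grids, and grid cells against `rect x r`. -/
theorem mu_absCoord_mem_rect_le_mul_box (hκ : ∀ j, 0 ≤ κ j) (x : Fin d → ℝ) {ρ : ℝ} (hρ : 0 < ρ)
    {a b : Fin d → ℝ} (ha : ∀ j, 0 ≤ a j) (hab : ∀ j, a j < b j) (h1 : ∀ j, ρ ≤ 12 * (b j - a j))
    (h2 : ∀ j, |x j| + ρ ≤ 24 * b j) :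
    mu κ {y | absCoord y ∈ rect x ρ} ≤
      boxConst κ * mu κ (Set.univ.pi fun j => Set.Ico (a j) (b j)) := by
  have hb : ∀ j, 0 < b j := fun j => (ha j).trans_lt (hab j)
  calc mu κ {y | absCoord y ∈ rect x ρ}
      ≤ ENNReal.ofReal (∏ j, 4 * ρ * ((|x j| + ρ) ^ κ j) ^ 2) := mu_absCoord_mem_rect_le hκ x hρ
    _ ≤ ENNReal.ofReal ((∏ j, 96 * ((48 : ℝ) ^ κ j) ^ 2) *
          ∏ j, (b j - a j) / 2 * ((b j / 2) ^ κ j) ^ 2) := by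
        refine ENNReal.ofReal_le_ofReal ?_
        rw [← Finset.prod_mul_distrib]
        refine Finset.prod_le_prod (fun j _ => by positivity) fun j _ => ?_
        have hpow : (|x j| + ρ) ^ κ j ≤ 48 ^ κ j * (b j / 2) ^ κ j := by
          rw [← Real.mul_rpow (by norm_num) (by linarith [hb j])]
          refine Real.rpow_le_rpow (by positivity) ?_ (hκ j)
          linarith [h2 j]
        calc 4 * ρ * ((|x j| + ρ) ^ κ j) ^ 2
            ≤ (48 * (b j - a j)) * (48 ^ κ j * (b j / 2) ^ κ j) ^ 2 := by
              have h3 : 4 * ρ ≤ 48 * (b j - a j) := by linarith [h1 j]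
              exact mul_le_mul h3 (pow_le_pow_left₀ (by positivity) hpow 2) (by positivity)
                (by linarith)
          _ = _ := by ring
    _ = boxConst κ * ENNReal.ofReal (∏ j, (b j - a j) / 2 * ((b j / 2) ^ κ j) ^ 2) := by
        rw [ENNReal.ofReal_mul (by positivity)]
        rfl
    _ ≤ _ := by
        gcongr
        exact le_mu_box hκ ha hab

theorem mu_box_ne_zero (hκ : ∀ j, 0 ≤ κ j) {a b : Fin d → ℝ} (ha : ∀ j, 0 ≤ a j)
    (hab : ∀ j, a j < b j) : mu κ (Set.univ.pi fun j => Set.Ico (a j) (b j)) ≠ 0 := by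
  refine (lt_of_lt_of_le (ENNReal.ofReal_pos.2 ?_) (le_mu_box hκ ha hab)).ne'
  refine Finset.prod_pos fun j _ => ?_
  have h1 := hab j
  have h2 := ha j
  have h3 : 0 < (b j / 2) ^ κ j := Real.rpow_pos_of_pos (by linarith) _
  have h4 : 0 < (b j - a j) / 2 := by linarith
  positivity

theorem cell_subset (σ : Fin d → Bool) (k : ℤ) (x : Fin d → ℝ) :
    {y | grid σ k y = grid σ k x} ⊆ {y | absCoord y ∈ rect x (2 ^ k)} := by
  intro y hy j _
  have h := abs_lt.1 (abs_sub_lt_of_gridIndex_eq (congrFun hy j))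
  exact ⟨max_le (abs_nonneg _) (by simp only [absCoord]; linarith),
    by simp only [absCoord]; linarith⟩

theorem exists_box_subset_cell (σ : Fin d → Bool) (k : ℤ) (x : Fin d → ℝ) :
    ∃ a b : Fin d → ℝ, (∀ j, 0 ≤ a j) ∧ (∀ j, a j < b j) ∧ (∀ j, |x j| < b j) ∧
      (∀ j, (2 : ℝ) ^ k ≤ 3 * (b j - a j)) ∧
      (Set.univ.pi fun j => Set.Ico (a j) (b j)) ⊆ {y | grid σ k y = grid σ k x} := by
  choose a b h1 h2 h3 h4 h5 using fun j => exists_Ico_gridIndex (σ j) k (x j)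
  exact ⟨a, b, h1, h2, h3, h4, fun y hy => funext fun j => h5 j (y j) (hy j (Set.mem_univ j))⟩

/-- For doubling, the parent cell lies in the symmetrized rectangle of radius `2 ^ (k + 1)` about
`x`, while the cell contains a box with sides at least `2 ^ k / 3` reaching beyond `|x j|` in each
coordinate. -/
theorem isDyadic_grid (hκ : ∀ j, 0 ≤ κ j) (σ : Fin d → Bool) (J : ℕ) :
    IsDyadic (mu κ) (fun k : ℕ => grid σ (k - J)) (boxConst κ) where
  measurableSet_fiber k i := measurable_grid σ _ (measurableSet_singleton i)
  nested k x y h := by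
    have hk : ((k + 1 : ℕ) : ℤ) - J = (k : ℤ) - J + 1 := by push_cast; ring
    simp only [hk]
    funext j
    obtain ⟨e, he⟩ := exists_gridIndex_succ (σ j) ((k : ℤ) - J)
    have hj := congrFun h j
    simp only [grid] at hj ⊢
    rw [he, he, hj]
  ne_zero k x := by
    obtain ⟨a, b, h1, h2, -, -, h5⟩ := exists_box_subset_cell σ ((k : ℤ) - J) x
    exact fun h => mu_box_ne_zero hκ h1 h2 (measure_mono_null h5 h)
  ne_top k x := by
    refine ne_top_of_le_ne_top ?_ ((measure_mono (cell_subset σ _ x)).trans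
      (mu_absCoord_mem_rect_le hκ x (by positivity)))
    exact ENNReal.ofReal_ne_top
  doubling k x := by
    obtain ⟨a, b, h1, h2, h3, h4, h5⟩ := exists_box_subset_cell σ ((k : ℤ) - J) x
    have hk : ((k + 1 : ℕ) : ℤ) - J = (k : ℤ) - J + 1 := by push_cast; ring
    have hz : (2 : ℝ) ^ ((k : ℤ) - J + 1) = 2 ^ ((k : ℤ) - J) * 2 := zpow_add_one₀ two_ne_zero _
    simp only [hk]
    refine (measure_mono (cell_subset σ _ x)).trans
      ((mu_absCoord_mem_rect_le_mul_box hκ x (by positivity) h1 h2 (fun j => ?_)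
        fun j => ?_).trans ?_)
    · rw [hz]
      linarith [h4 j, h2 j]
    · rw [hz]
      linarith [h4 j, h2 j, h3 j, h1 j]
    · gcongr

/-- The maximal operator is dominated by finitely many dyadic maximal operators. -/
theorem maximalR_le (hκ : ∀ j, 0 ≤ κ j) (f : (Fin d → ℝ) → ℂ) (x : Fin d → ℝ) :
    maximalR κ f x ≤ boxConst κ *
      ∑ σ : Fin d → Bool, dmaxZ (mu κ) (grid σ) (fun y => ‖f y‖ₑ) x := by
  refine iSup₂_le fun r hr => ?_
  -- The intervals have length at most `2 * r`, so a side `2 ^ k > 6 * r` is what the one-third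
  -- trick needs; choosing `2 ^ k ≤ 12 * r` keeps the cell comparable to the rectangle.
  obtain ⟨n, hn1, hn2⟩ := exists_mem_Ico_zpow (x := 6 * r) (y := (2 : ℝ)) (by positivity)
    one_lt_two
  set k := n + 1 with hk
  have hz : (2 : ℝ) ^ k = 2 ^ n * 2 := zpow_add_one₀ two_ne_zero n
  -- The suitable grid is chosen in each coordinate independently, hence the sum over all `σ : Fin d
  -- → Bool`.
  have hσ : ∀ j, ∃ s, ∀ t ∈ {t : ℝ | |t| ∈ interval (x j) r},
      ∀ u ∈ {t : ℝ | |t| ∈ interval (x j) r}, gridIndex s k t = gridIndex s k u := by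
    intro j
    refine exists_gridIndex_eq fun t ht u hu => ?_
    have h1 : |t| < |x j| + r := ht.2
    have h2 : |x j| - r ≤ |u| := (le_max_right _ _).trans hu.1
    linarith
  choose σ hσ using hσ
  have hx : ∀ j, x j ∈ {t : ℝ | |t| ∈ interval (x j) r} := fun j =>
    ⟨max_le (abs_nonneg _) (by linarith), by linarith⟩
  have hsub : {y | absCoord y ∈ rect x r} ⊆ {y | grid σ k y = grid σ k x} := fun y hy =>
    funext fun j => hσ j (y j) (hy j (Set.mem_univ j)) (x j) (hx j)
  have ha : ∀ j, 0 ≤ max 0 (|x j| - r) := fun j => le_max_left _ _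
  have hlen : ∀ j, r ≤ |x j| + r - max 0 (|x j| - r) := fun j => by
    have : max 0 (|x j| - r) ≤ |x j| := max_le (abs_nonneg _) (by linarith)
    linarith
  have hab : ∀ j, max 0 (|x j| - r) < |x j| + r := fun j => by linarith [hlen j]
  have hμ : mu κ {y | grid σ k y = grid σ k x} ≤ boxConst κ * mu κ (rect x r) := by
    refine (measure_mono (cell_subset σ k x)).trans
      (mu_absCoord_mem_rect_le_mul_box hκ x (by positivity) ha hab (fun j => ?_) fun j => ?_)
    · linarith [hlen j]
    · linarith [abs_nonneg (x j)]
  have h0 : mu κ (rect x r) ≠ 0 := mu_box_ne_zero hκ ha hab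
  have ht : mu κ (rect x r) ≠ ∞ := by
    refine ne_top_of_le_ne_top ENNReal.ofReal_ne_top
      (le_trans (measure_mono fun y hy => ?_) (mu_absCoord_mem_rect_le hκ x hr))
    have : absCoord y = y := funext fun j =>
      abs_of_nonneg ((ha j).trans (hy j (Set.mem_univ j)).1)
    simpa [this] using hy
  have hinv : (mu κ (rect x r))⁻¹ ≤ boxConst κ * (mu κ {y | grid σ k y = grid σ k x})⁻¹ := by
    have hle := (isDyadic_grid hκ σ k.natAbs).ne_zero (k + k.natAbs).toNat x
    have hkk : (((k + k.natAbs).toNat : ℕ) : ℤ) - k.natAbs = k := by omega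
    simp only [hkk] at hle
    have hcell0 : mu κ {y | grid σ k y = grid σ k x} ≠ ∞ :=
      ne_top_of_le_ne_top (by finiteness) hμ
    rw [← div_eq_mul_inv, ENNReal.le_div_iff_mul_le (Or.inl hle) (Or.inl hcell0), mul_comm,
      ← div_eq_mul_inv]
    exact ENNReal.div_le_of_le_mul hμ
  calc (mu κ (rect x r))⁻¹ * ∫⁻ y in {y | absCoord y ∈ rect x r}, ‖f y‖ₑ ∂mu κ
      ≤ (boxConst κ * (mu κ {y | grid σ k y = grid σ k x})⁻¹) *
          ∫⁻ y in {y | grid σ k y = grid σ k x}, ‖f y‖ₑ ∂mu κ := by gcongr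
    _ = boxConst κ * condE (mu κ) (grid σ k) (fun y => ‖f y‖ₑ) x := by rw [condE, mul_assoc]
    _ ≤ boxConst κ * dmaxZ (mu κ) (grid σ) (fun y => ‖f y‖ₑ) x := by
        gcongr
        exact le_iSup (fun k : ℤ => condE (mu κ) (grid σ k) (fun y => ‖f y‖ₑ) x) k
    _ ≤ _ := by
        gcongr
        exact Finset.single_le_sum (f := fun σ : Fin d → Bool =>
          dmaxZ (mu κ) (grid σ) (fun y => ‖f y‖ₑ) x) (fun _ _ => zero_le) (Finset.mem_univ σ)

end measure

/-! ### Measurability of the maximal function and the final inequalities. -/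

variable {d : ℕ} {κ : Fin d → ℝ}

theorem mem_rect_absCoord_iff {x y : Fin d → ℝ} {r : ℝ} :
    absCoord y ∈ rect x r ↔ ∀ j, |x j| - r ≤ |y j| ∧ |y j| < |x j| + r := by
  simp [rect, interval, absCoord]

/-- These hyperplanes carry the closed left faces of the rectangles, which are missed when the
radius is approached from below. -/
theorem mu_abs_eq_null (κ : Fin d → ℝ) (j : Fin d) (a : ℝ) :
    mu κ {y | |y j| = a} = 0 := by
  refine withDensity_absolutelyContinuous _ _ (measure_mono_null
    (t := {y | y j = a} ∪ {y | y j = -a}) (fun y hy => ?_) (measure_union_null ?_ ?_))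
  · have hy' : |y j| = a := hy
    rcases abs_choice (y j) with h | h
    · exact Or.inl (h.symm.trans hy')
    · exact Or.inr (by rw [h] at hy'; simp only [Set.mem_ofPred_eq]; linarith)
  · exact Measure.pi_hyperplane (fun _ : Fin d => (volume : Measure ℝ)) j a
  · exact Measure.pi_hyperplane (fun _ : Fin d => (volume : Measure ℝ)) j (-a)

theorem rect_mono {x : Fin d → ℝ} {r s : ℝ} (h : r ≤ s) : rect x r ⊆ rect x s :=
  Set.pi_mono fun _ _ => Set.Ico_subset_Ico (max_le_max le_rfl (by linarith)) (by linarith)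

/-- Rational radii suffice in the definition of the maximal function. -/
theorem maximalR_eq_iSup_rat (κ : Fin d → ℝ) (f : (Fin d → ℝ) → ℂ) (x : Fin d → ℝ) :
    maximalR κ f x = ⨆ (q : ℚ) (_ : 0 < q), (mu κ (rect x q))⁻¹ *
      ∫⁻ y in {y | absCoord y ∈ rect x q}, ‖f y‖ₑ ∂(mu κ) := by
  refine le_antisymm (iSup₂_le fun r hr => ?_)
    (iSup₂_le fun q hq => le_iSup₂_of_le (q : ℝ) (by exact_mod_cast hq) le_rfl)
  -- With rational radii increasing to `r`, the domains of integration exhaust that of `r` up to a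
  -- null set, and the smaller rectangles only increase the factor `(mu κ _)⁻¹`.
  obtain ⟨q, hqm, hqr, hqt, hq0⟩ : ∃ q : ℕ → ℚ, StrictMono q ∧ (∀ n, (q n : ℝ) < r) ∧
      Filter.Tendsto (fun n => (q n : ℝ)) Filter.atTop (nhds r) ∧ ∀ n, 0 < q n := by
    obtain ⟨q, hqm, hqr, hqt⟩ := Real.exists_seq_rat_strictMono_tendsto r
    obtain ⟨N, hN⟩ := (hqt.eventually (lt_mem_nhds hr)).exists
    refine ⟨fun n => q (n + N), fun m n h => hqm (by omega), fun n => hqr _,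
      hqt.comp (Filter.tendsto_add_atTop_nat N), fun n => ?_⟩
    have hN' : 0 < q N := by exact_mod_cast hN
    exact hN'.trans_le (hqm.monotone (by omega))
  set S : ℝ → Set (Fin d → ℝ) := fun r => {y | absCoord y ∈ rect x r} with hS
  have hSmono : Monotone fun n => S (q n) := fun m n hmn y hy =>
    rect_mono (by exact_mod_cast hqm.monotone hmn) hy
  have hnull : mu κ (⋃ j, {y : Fin d → ℝ | |y j| = |x j| - r}) = 0 :=
    measure_iUnion_null fun j => mu_abs_eq_null κ j _
  have hae : S r ≤ᵐ[mu κ] ⋃ n, S (q n) := by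
    filter_upwards [measure_eq_zero_iff_ae_notMem.1 hnull] with y hy hyS
    have hyS' := mem_rect_absCoord_iff.1 hyS
    have hev : ∀ j, ∀ᶠ n in Filter.atTop, |x j| - q n < |y j| ∧ |y j| < |x j| + q n := by
      intro j
      have h1 : |x j| - r < |y j| := by
        refine lt_of_le_of_ne (hyS' j).1 fun h => hy (Set.mem_iUnion.2 ⟨j, ?_⟩)
        exact h.symm
      have h2 := (hyS' j).2
      have h3 : ∀ᶠ n in Filter.atTop, |x j| - |y j| < q n :=
        hqt.eventually (lt_mem_nhds (by linarith))
      have h4 : ∀ᶠ n in Filter.atTop, |y j| - |x j| < q n :=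
        hqt.eventually (lt_mem_nhds (by linarith))
      filter_upwards [h3, h4] with n h3 h4
      constructor <;> linarith
    obtain ⟨n, hn⟩ := (Filter.eventually_all.2 hev).exists
    exact Set.mem_iUnion.2 ⟨n, mem_rect_absCoord_iff.2 fun j => ⟨(hn j).1.le, (hn j).2⟩⟩
  calc (mu κ (rect x r))⁻¹ * ∫⁻ y in S r, ‖f y‖ₑ ∂(mu κ)
      ≤ (mu κ (rect x r))⁻¹ * ∫⁻ y in ⋃ n, S (q n), ‖f y‖ₑ ∂(mu κ) := by
        gcongr 1
        exact lintegral_mono' (Measure.restrict_mono_ae hae) le_rfl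
    _ = ⨆ n, (mu κ (rect x r))⁻¹ * ∫⁻ y in S (q n), ‖f y‖ₑ ∂(mu κ) := by
        rw [setLIntegral_iUnion_of_directed _ hSmono.directed_le, ENNReal.mul_iSup]
    _ ≤ _ := by
        refine iSup_le fun n => ?_
        have hle : (mu κ (rect x r))⁻¹ * ∫⁻ y in S (q n), ‖f y‖ₑ ∂(mu κ) ≤
            (mu κ (rect x (q n)))⁻¹ * ∫⁻ y in S (q n), ‖f y‖ₑ ∂(mu κ) := by
          gcongr
          exact rect_mono (hqr n).le
        exact hle.trans (le_iSup₂_of_le (q n) (hq0 n) le_rfl)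

/-- The supremum over rational radii is countable, and each term is measurable in `x` by Tonelli,
the rectangles being sections of measurable sets of pairs. -/
theorem measurable_maximalR (κ : Fin d → ℝ) {f : (Fin d → ℝ) → ℂ} (hf : Measurable f) :
    Measurable (maximalR κ f) := by
  have hsym : ∀ q : ℝ,
      MeasurableSet {z : (Fin d → ℝ) × (Fin d → ℝ) | absCoord z.2 ∈ rect z.1 q} := by
    intro q
    have : {z : (Fin d → ℝ) × (Fin d → ℝ) | absCoord z.2 ∈ rect z.1 q} =
        ⋂ j, {z | |z.1 j| - q ≤ |z.2 j|} ∩ {z | |z.2 j| < |z.1 j| + q} := by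
      ext z
      simp [mem_rect_absCoord_iff]
    rw [this]
    exact MeasurableSet.iInter fun j => (measurableSet_le (by fun_prop) (by fun_prop)).inter
      (measurableSet_lt (by fun_prop) (by fun_prop))
  have hrect : ∀ q : ℝ, MeasurableSet {z : (Fin d → ℝ) × (Fin d → ℝ) | z.2 ∈ rect z.1 q} := by
    intro q
    have : {z : (Fin d → ℝ) × (Fin d → ℝ) | z.2 ∈ rect z.1 q} =
        ⋂ j, {z | max 0 (|z.1 j| - q) ≤ z.2 j} ∩ {z | z.2 j < |z.1 j| + q} := by
      ext z
      simp [rect, interval]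
    rw [this]
    exact MeasurableSet.iInter fun j => (measurableSet_le (by fun_prop) (by fun_prop)).inter
      (measurableSet_lt (by fun_prop) (by fun_prop))
  have heq : maximalR κ f = fun x => ⨆ (q : ℚ) (_ : 0 < q), (mu κ (rect x q))⁻¹ *
      ∫⁻ y in {y | absCoord y ∈ rect x q}, ‖f y‖ₑ ∂(mu κ) :=
    funext fun x => maximalR_eq_iSup_rat κ f x
  rw [heq]
  refine Measurable.iSup fun q => Measurable.iSup fun _ => Measurable.mul ?_ ?_
  · exact (measurable_measure_prodMk_left (hrect q)).inv
  · have h : ∀ x : Fin d → ℝ, ∫⁻ y in {y | absCoord y ∈ rect x q}, ‖f y‖ₑ ∂(mu κ) =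
        ∫⁻ y, {z : (Fin d → ℝ) × (Fin d → ℝ) | absCoord z.2 ∈ rect z.1 q}.indicator
          (fun z => ‖f z.2‖ₑ) (x, y) ∂(mu κ) := fun x =>
      (lintegral_indicator (measurable_absCoord (measurableSet_rect x q)) _).symm
    simp_rw [h]
    exact Measurable.lintegral_prod_right'
      ((hf.comp measurable_snd).enorm.indicator (hsym q))

/-- Allows almost everywhere measurable functions to be replaced by measurable representatives
without changing the maximal function at any point. -/
theorem maximalR_congr_ae {f g : (Fin d → ℝ) → ℂ} (h : f =ᵐ[mu κ] g) :
    maximalR κ f = maximalR κ g := by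
  have hint : ∀ S : Set (Fin d → ℝ), ∫⁻ y in S, ‖f y‖ₑ ∂(mu κ) = ∫⁻ y in S, ‖g y‖ₑ ∂(mu κ) :=
    fun S => lintegral_congr_ae (ae_restrict_of_ae (h.mono fun y hy => congrArg enorm hy))
  funext x
  simp only [maximalR, hint]

theorem measurable_lrNorm (r : ℝ) {g : ℕ → (Fin d → ℝ) → ℝ≥0∞} (hg : ∀ n, Measurable (g n)) :
    Measurable (lrNorm r g) :=
  measurable_lr r hg

theorem lrNorm_congr_ae (r : ℝ) {f g : ℕ → (Fin d → ℝ) → ℂ} (h : ∀ n, f n =ᵐ[mu κ] g n) :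
    lrNorm r (fun n x => ‖f n x‖ₑ) =ᵐ[mu κ] lrNorm r fun n x => ‖g n x‖ₑ := by
  filter_upwards [ae_all_iff.2 h] with x hx
  simp only [lrNorm, hx]

theorem eLpNorm_ofReal_eq {p : ℝ} (hp : 0 < p) (g : (Fin d → ℝ) → ℝ≥0∞) :
    eLpNorm g (ENNReal.ofReal p) (mu κ) = (∫⁻ x, g x ^ p ∂(mu κ)) ^ (1 / p) := by
  rw [eLpNorm_eq_lintegral_rpow_enorm_toReal (by simpa using hp) ENNReal.ofReal_ne_top,
    ENNReal.toReal_ofReal hp.le]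
  simp

theorem strong_type_lrNorm_maximalR (hκ : ∀ j, 0 ≤ κ j) {r p : ℝ} (hr : 1 < r) (hp : 1 < p) :
    ∃ C : ℝ≥0, 0 < C ∧
      ∀ f : ℕ → (Fin d → ℝ) → ℂ, (∀ n, AEMeasurable (f n) (mu κ)) →
        MemLp (lrNorm r fun n x => ‖f n x‖ₑ) (ENNReal.ofReal p) (mu κ) →
          MemLp (lrNorm r fun n => maximalR κ (f n)) (ENNReal.ofReal p) (mu κ) ∧
            eLpNorm (lrNorm r fun n => maximalR κ (f n)) (ENNReal.ofReal p) (mu κ) ≤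
              C * eLpNorm (lrNorm r fun n x => ‖f n x‖ₑ) (ENNReal.ofReal p) (mu κ) := by
  obtain ⟨K, hK⟩ := exists_lintegral_lr_rpow_le_of_le_sum (μ := mu κ) (boxConst κ) (boxConst κ)
    hr hp (fun σ : Fin d → Bool => grid σ) (isDyadic_grid hκ)
  have hp0 : 0 < p := by linarith
  -- `K` bounds the integrals of `p`-th powers, so the norm bound takes its root; `K + 1` makes the
  -- constant positive.
  refine ⟨(K + 1) ^ (1 / p), NNReal.rpow_pos (by positivity), fun f hf hF => ?_⟩
  set g : ℕ → (Fin d → ℝ) → ℂ := fun n => (hf n).mk (f n)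
  have hg : ∀ n, Measurable (g n) := fun n => (hf n).measurable_mk
  have hfg : ∀ n, f n =ᵐ[mu κ] g n := fun n => (hf n).ae_eq_mk
  have hM : ∀ n, maximalR κ (f n) = maximalR κ (g n) := fun n => maximalR_congr_ae (hfg n)
  have hbound : eLpNorm (lrNorm r fun n => maximalR κ (f n)) (ENNReal.ofReal p) (mu κ) ≤
      ((K + 1) ^ (1 / p) : ℝ≥0) *
        eLpNorm (lrNorm r fun n x => ‖f n x‖ₑ) (ENNReal.ofReal p) (mu κ) := by
    rw [eLpNorm_congr_ae (lrNorm_congr_ae r hfg)]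
    simp_rw [hM]
    rw [eLpNorm_ofReal_eq hp0, eLpNorm_ofReal_eq hp0, ENNReal.coe_rpow_of_nonneg _ (by positivity),
      ← ENNReal.mul_rpow_of_nonneg _ _ (by positivity)]
    refine ENNReal.rpow_le_rpow ?_ (by positivity)
    refine (hK (fun n x => ‖g n x‖ₑ) (fun n => maximalR κ (g n)) (fun n => (hg n).enorm)
      fun n x => maximalR_le hκ (g n) x).trans ?_
    push_cast
    exact mul_le_mul' le_self_add le_rfl
  refine ⟨⟨?_, hbound.trans_lt (ENNReal.mul_lt_top ENNReal.coe_lt_top hF.2)⟩, hbound⟩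
  simp_rw [hM]
  exact (measurable_lrNorm r fun n => measurable_maximalR κ (hg n)).aestronglyMeasurable

theorem weak_type_lrNorm_maximalR (hκ : ∀ j, 0 ≤ κ j) {r : ℝ} (hr : 1 < r) :
    ∃ C : ℝ≥0, 0 < C ∧
      ∀ f : ℕ → (Fin d → ℝ) → ℂ, (∀ n, AEMeasurable (f n) (mu κ)) → ∀ lam : ℝ, 0 < lam →
        mu κ {x | ENNReal.ofReal lam < lrNorm r (fun n => maximalR κ (f n)) x} ≤
          C / ENNReal.ofReal lam * eLpNorm (lrNorm r fun n x => ‖f n x‖ₑ) 1 (mu κ) := by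
  obtain ⟨K, hK⟩ := exists_mul_measure_lr_le_of_le_sum (μ := mu κ) (boxConst κ) (boxConst κ)
    hr (fun σ : Fin d → Bool => grid σ) (isDyadic_grid hκ)
  refine ⟨K + 1, by positivity, fun f hf lam hlam => ?_⟩
  set g : ℕ → (Fin d → ℝ) → ℂ := fun n => (hf n).mk (f n)
  have hg : ∀ n, Measurable (g n) := fun n => (hf n).measurable_mk
  have hfg : ∀ n, f n =ᵐ[mu κ] g n := fun n => (hf n).ae_eq_mk
  have hM : ∀ n, maximalR κ (f n) = maximalR κ (g n) := fun n => maximalR_congr_ae (hfg n)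
  have ha0 : ENNReal.ofReal lam ≠ 0 := by simpa using hlam
  rw [eLpNorm_congr_ae (lrNorm_congr_ae r hfg), eLpNorm_one_eq_lintegral_enorm]
  simp_rw [hM, enorm_eq_self]
  have h := hK (fun n x => ‖g n x‖ₑ) (fun n => maximalR κ (g n)) (fun n => (hg n).enorm)
    (fun n x => maximalR_le hκ (g n) x) _ ha0 ENNReal.ofReal_ne_top
  rw [div_eq_mul_inv, mul_right_comm, ← div_eq_mul_inv,
    ENNReal.le_div_iff_mul_le (Or.inl ha0) (Or.inl ENNReal.ofReal_ne_top), mul_comm]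
  refine h.trans ?_
  push_cast
  exact mul_le_mul' le_self_add le_rfl

end Dunkl

theorem mainTheorem3 (d : ℕ) (κ : Fin d → ℝ) (hκ : ∀ j, 0 ≤ κ j) :
    (∀ r p : ℝ, 1 < r → 1 < p → ∃ C : ℝ≥0, 0 < C ∧
      ∀ f : ℕ → (Fin d → ℝ) → ℂ, (∀ n, AEMeasurable (f n) (Dunkl.mu κ)) →
        MemLp (Dunkl.lrNorm r fun n x => ‖f n x‖ₑ) (ENNReal.ofReal p) (Dunkl.mu κ) →
          MemLp (Dunkl.lrNorm r fun n => Dunkl.maximalR κ (f n))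
              (ENNReal.ofReal p) (Dunkl.mu κ) ∧
            eLpNorm (Dunkl.lrNorm r fun n => Dunkl.maximalR κ (f n))
                (ENNReal.ofReal p) (Dunkl.mu κ) ≤
              C * eLpNorm (Dunkl.lrNorm r fun n x => ‖f n x‖ₑ)
                (ENNReal.ofReal p) (Dunkl.mu κ)) ∧
    (∀ r : ℝ, 1 < r → ∃ C : ℝ≥0, 0 < C ∧
      ∀ f : ℕ → (Fin d → ℝ) → ℂ, (∀ n, AEMeasurable (f n) (Dunkl.mu κ)) →
        MemLp (Dunkl.lrNorm r fun n x => ‖f n x‖ₑ) 1 (Dunkl.mu κ) →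
          ∀ lam : ℝ, 0 < lam →
            Dunkl.mu κ {x | ENNReal.ofReal lam <
                Dunkl.lrNorm r (fun n => Dunkl.maximalR κ (f n)) x} ≤
              C / ENNReal.ofReal lam *
                eLpNorm (Dunkl.lrNorm r fun n x => ‖f n x‖ₑ) 1 (Dunkl.mu κ)) := by
  exact ⟨fun r p hr hp => Dunkl.strong_type_lrNorm_maximalR hκ hr hp, fun r hr => by
    obtain ⟨C, hC, h⟩ := Dunkl.weak_type_lrNorm_maximalR hκ hr
    exact ⟨C, hC, fun f hf _ lam hlam => h f hf lam hlam⟩⟩
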